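/- Let $d\ge 0$ be an integer, $G=\mathrm{SL}(d+1,\mathbb R)$, and for $t\in\mathbb R$, $r>0$, $x\in\mathbb R^d$ put $$a_t=\begin{pmatrix}e^{dt}&0\\0&e^{-t}I_d\end{pmatrix},\qquad g_r=\begin{pmatrix}r^{-d/(d+1)}&0\\0&r^{1/(d+1)}I_d\end{pmatrix},\qquad u(x)=\begin{pmatrix}1&x\\0&I_d\end{pmatrix}\in G .$$ **IFS.** Let $\mathcal F=\{h_i=\rho_iO_i+b_i : i\in\Lambda\}$ be a finite family of similarities of $\mathbb R^d$, with $0<\rho_i<1$, $O_i\in\mathrm{SO}(d,\mathbb R)$, $b_i\in\mathbb R^d$, satisfying the open set condition: there is a non-empty open $U\subset\mathbb R^d$ with $h_i(U)\subseteq U$ for all $i$ and $h_i(U)\cap h_j(U)=\emptyset$ for $i\ne j$. Let $\mathcal K$ be its limit set (the unique non-empty compact set with $\mathcal K=\bigcup_i h_i(\mathcal K)$), $s=\dim_H(\mathcal K)$, and let $\mu=H^s|_{\mathcal K}/H^s(\mathcal K)$ be the normalized restriction of the $s$-dimensional Hausdorff measure to $\mathcal K$. Fix a linear order on $\Lambda$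 and order $\Lambda^n$ lexicographically. For $\omega\in\Lambda^n$ let $\mathcal K_\omega=h_{\omega_1}\circ\cdots\circ h_{\omega_n}(\mathcal K)$, $\hat{\mathcal K}_\omega=\mathcal K_\omega\setminus\bigcup_{\alpha>\omega}\mathcal K_\alpha$ (a partition of $\mathcal K$ as $\omega$ runs over $\Lambda^n$), and for $x\in\hat{\mathcal K}_\omega$ let $\rho(x,n)=\prod_{j=1}^n\rho_{\omega_j}$. **Contraction hypothesis.** Let $X$ be a metric space with an action of $G$, let $\mathscr F=\{f_k:X\to(0,\infty] : k=1,2,\dots\}$ and let $0\le\gamma_0<\beta$ be real. The measure $\mu$ satisfies the $(\mathcal F,\mathscr F,\beta,\gamma_0)$-contraction hypothesis on $X$ if: 1. the set $\{f_k=\infty\}$ is independent of $k$ and $G$-invariant; 2. every $f_k$ is $\mathrm{SO}(d+1,\mathbb R)$-invariant, and for every bounded neighborhood $\mathcal O$ of the identity in $G$ there is $C\ge1$ such that $C^{-1}f_k(y)\le f_k(gy)\le Cf_k(y)$ for all $g\in\mathcal O$, $y\in X$, $k\ge1$; 3. there is $c\ge1$ such that for every $k\ge1$ and every $\gamma\in[\gamma_0,\beta]$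 there is $T>0$ such that for all $y\in X$ with $f_k(y)>T$, $$\int_{\mathcal K}\rho(x,k)^{-\gamma}f_k\big(g_{\rho(x,k)}u(x)y\big)\,d\mu(x)\le c\,f_k(y)\Big(\int_{\mathcal K}\rho(x,k)\,d\mu(x)\Big)^{\beta-\gamma}.$$ For $y\in X$, the orbit $(a_ty)_{t\ge0}$ is $\mathscr F$-divergent on average if for every $k\ge1$ and $M>0$, $\frac1T\int_0^T\chi_{\{f_k\le M\}}(a_ty)\,dt\to0$ as $T\to\infty$. (No measurability of $f_k$ is assumed; both integrals of non-negative functions involving $f_k$ are read as lower Lebesgue integrals.) **Theorem.** Assume that $\mu$ satisfies the $(\mathcal F,\mathscr F,\beta,\gamma_0)$-contraction hypothesis on $X$, where $0\le\gamma_0<\beta\le s$. Then for every $x_0\in X$ with $f_1(x_0)<\infty$, $$\dim_H\big\{x\in\mathcal K : (a_tu(x)x_0)_{t\ge0}\text{ is }\mathscr F\text{-divergent on average}\big\}\le s-\beta .$$ -/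

import Mathlib

open MeasureTheory Filter Topology
open scoped ENNReal NNReal MatrixGroups

namespace FractalDivergence

/-- A finite iterated function system of orientation-preserving contracting similarities
`h i = ρ i • O i + b i` of `ℝ^d`, indexed by `Λ`. -/
structure IFS (d : ℕ) (Λ : Type*) where
  /-- contraction ratios -/
  ratio : Λ → ℝ
  /-- rotation parts -/
  rot : Λ → Matrix (Fin d) (Fin d) ℝ
  /-- translation parts -/
  trans : Λ → EuclideanSpace ℝ (Fin d)
  ratio_pos : ∀ i, 0 < ratio i
  ratio_lt_one : ∀ i, ratio i < 1
  rot_mem : ∀ i, rot i ∈ Matrix.specialOrthogonalGroup (Fin d) ℝ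

namespace IFS

variable {d : ℕ} {Λ : Type*}

/-- The similarity `h_i`. -/
noncomputable def map (F : IFS d Λ) (i : Λ) (x : EuclideanSpace ℝ (Fin d)) :
    EuclideanSpace ℝ (Fin d) :=
  F.ratio i • Matrix.toEuclideanLin (F.rot i) x + F.trans i

/-- `K` is the limit set of `F`: the (unique) non-empty compact set with `K = ⋃ i, h_i(K)`. -/
structure IsLimitSet (F : IFS d Λ) (K : Set (EuclideanSpace ℝ (Fin d))) : Prop where
  isCompact : IsCompact K
  nonempty : K.Nonempty
  eq_iUnion : K = ⋃ i, F.map i '' K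

/-- The open set condition. -/
def OpenSetCondition (F : IFS d Λ) : Prop :=
  ∃ U : Set (EuclideanSpace ℝ (Fin d)), IsOpen U ∧ U.Nonempty ∧
    (∀ i, F.map i '' U ⊆ U) ∧ ∀ i j, i ≠ j → F.map i '' U ∩ F.map j '' U = ∅

/-- `h_ω = h_{ω_1} ∘ ⋯ ∘ h_{ω_n}` for a word `ω ∈ Λ^n`. -/
noncomputable def wordMap (F : IFS d Λ) :
    (n : ℕ) → (Fin n → Λ) → EuclideanSpace ℝ (Fin d) → EuclideanSpace ℝ (Fin d)
  | 0, _ => id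
  | n + 1, ω => F.map (ω 0) ∘ wordMap F n (Fin.tail ω)

/-- `ρ_ω = ∏ ρ_{ω_j}` for a word `ω ∈ Λ^n`. -/
noncomputable def wordRatio (F : IFS d Λ) {n : ℕ} (ω : Fin n → Λ) : ℝ := ∏ j, F.ratio (ω j)

/-- `K_ω = h_ω(K)`. -/
def piece (F : IFS d Λ) (K : Set (EuclideanSpace ℝ (Fin d))) {n : ℕ} (ω : Fin n → Λ) :
    Set (EuclideanSpace ℝ (Fin d)) :=
  F.wordMap n ω '' K

/-- The disjoint pieces `K̂_ω = K_ω \ ⋃_{α > ω} (K_ω ∩ K_α)`, where words of length `n` are compared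
lexicographically. -/
def hatPiece [LinearOrder Λ] (F : IFS d Λ) (K : Set (EuclideanSpace ℝ (Fin d))) {n : ℕ}
    (ω : Fin n → Λ) : Set (EuclideanSpace ℝ (Fin d)) :=
  F.piece K ω \ ⋃ α : Fin n → Λ, ⋃ _ : toLex ω < toLex α, F.piece K ω ∩ F.piece K α

/-- The function `ρ(x, n)` on `K`. The sets `K̂_ω`, `ω ∈ Λ^n`, partition `K`, so for `x ∈ K` exactly
one summand is non-zero and `ρ(x, n) = ρ_ω` for the unique `ω` with `x ∈ K̂_ω`. (The value off `K`
is `0` and is never used.) -/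
noncomputable def cocycle [Fintype Λ] [LinearOrder Λ] (F : IFS d Λ)
    (K : Set (EuclideanSpace ℝ (Fin d))) (x : EuclideanSpace ℝ (Fin d)) (n : ℕ) : ℝ :=
  ∑ ω : Fin n → Λ, (F.hatPiece K ω).indicator (fun _ => F.wordRatio ω) x

end IFS

/-- `a_t = diag(e^{dt}, e^{-t}, …, e^{-t}) ∈ SL(d+1, ℝ)`. -/
noncomputable def aFlow (d : ℕ) (t : ℝ) : SL(d + 1, ℝ) :=
  ⟨Matrix.diagonal (Fin.cons (Real.exp (d * t)) fun _ : Fin d => Real.exp (-t)), by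
    rw [Matrix.det_diagonal, Fin.prod_univ_succ]
    simp [← Real.exp_nat_mul, ← Real.exp_add]⟩

/-- `g_r = diag(r^{-d/(d+1)}, r^{1/(d+1)}, …, r^{1/(d+1)}) ∈ SL(d+1, ℝ)` for `r > 0`. -/
noncomputable def gPos (d : ℕ) (r : ℝ) (hr : 0 < r) : SL(d + 1, ℝ) :=
  ⟨Matrix.diagonal (Fin.cons (r ^ (-(d : ℝ) / (d + 1))) fun _ : Fin d => r ^ (1 / ((d : ℝ) + 1))),
    by
      rw [Matrix.det_diagonal, Fin.prod_univ_succ]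
      simp only [Fin.cons_zero, Fin.cons_succ, Finset.prod_const, Finset.card_univ,
        Fintype.card_fin]
      rw [← Real.rpow_mul_natCast hr.le, ← Real.rpow_add hr]
      have : -(d : ℝ) / (d + 1) + 1 / ((d : ℝ) + 1) * d = 0 := by ring
      rw [this, Real.rpow_zero]⟩

/-- `g_r` as a function of a real number `r`; the value for `r ≤ 0` is a convention and is never
used. -/
noncomputable def gFlow (d : ℕ) (r : ℝ) : SL(d + 1, ℝ) :=
  if hr : 0 < r then gPos d r hr else 1

/-- The unipotent matrix `u(x)` with first row `(1, x)` and lower rows `(0, I_d)`. -/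
noncomputable def uMat {d : ℕ} (x : EuclideanSpace ℝ (Fin d)) : SL(d + 1, ℝ) :=
  ⟨Matrix.of (Fin.cons (Fin.cons 1 fun j => x j)
      fun i : Fin d => Fin.cons 0 fun j : Fin d => (1 : Matrix (Fin d) (Fin d) ℝ) i j), by
    rw [Matrix.det_succ_column_zero, Fin.sum_univ_succ]
    have h : (Matrix.of (Fin.cons (Fin.cons 1 fun j => x j)
        fun i : Fin d => Fin.cons 0 fun j : Fin d =>
          (1 : Matrix (Fin d) (Fin d) ℝ) i j)).submatrix (Fin.succAbove 0) Fin.succ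
        = (1 : Matrix (Fin d) (Fin d) ℝ) := by
      ext i j
      simp
    rw [h]
    simp⟩

/-- The `(F, 𝓕, β, γ₀)`-contraction hypothesis on `X` for the measure `μ` on the limit set `K` of `F`
and the collection `𝓕 = (f_k)_{k ≥ 1}` of functions `X → (0, ∞]`. -/
structure ContractionHypothesis {d : ℕ} {Λ : Type*} [Fintype Λ] [LinearOrder Λ]
    {X : Type*} [MetricSpace X] [MulAction SL(d + 1, ℝ) X]
    (F : IFS d Λ) (K : Set (EuclideanSpace ℝ (Fin d))) (μ : Measure (EuclideanSpace ℝ (Fin d)))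
    (f : ℕ+ → X → ℝ≥0∞) (β γ₀ : ℝ) : Prop where
  /-- the functions are positive -/
  pos : ∀ k x, 0 < f k x
  /-- the set `{f_k = ∞}` does not depend on `k` -/
  top_indep : ∀ k l, {x | f k x = ∞} = {x | f l x = ∞}
  /-- the set `{f_k = ∞}` is invariant -/
  top_invariant : ∀ k x (g : SL(d + 1, ℝ)), f k x = ∞ → f k (g • x) = ∞
  /-- `f_k` is invariant under `SO(d+1, ℝ)` -/
  rot_invariant : ∀ k x (g : SL(d + 1, ℝ)),
    (g : Matrix (Fin (d + 1)) (Fin (d + 1)) ℝ) ∈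
      Matrix.specialOrthogonalGroup (Fin (d + 1)) ℝ → f k (g • x) = f k x
  /-- the `f_k` are uniformly log Lipschitz; a set of matrices is bounded when its entries are -/
  log_lipschitz : ∀ O : Set SL(d + 1, ℝ), O ∈ 𝓝 (1 : SL(d + 1, ℝ)) →
    (∃ R : ℝ, ∀ g ∈ O, ∀ i j, |g i j| ≤ R) →
    ∃ C : ℝ≥0, 1 ≤ C ∧ ∀ g ∈ O, ∀ x k,
      (C : ℝ≥0∞)⁻¹ * f k x ≤ f k (g • x) ∧ f k (g • x) ≤ C * f k x
  /-- the contraction inequality; `c` depends neither on `k` nor on `γ`, while `T` may -/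
  contraction : ∃ c : ℝ≥0, 1 ≤ c ∧ ∀ (k : ℕ+) (γ : ℝ), γ₀ ≤ γ → γ ≤ β →
    ∃ T : ℝ≥0, 0 < T ∧ ∀ y : X, (T : ℝ≥0∞) < f k y →
      ∫⁻ x in K, ENNReal.ofReal (F.cocycle K x k ^ (-γ)) *
          f k (gFlow d (F.cocycle K x k) • uMat x • y) ∂μ
        ≤ c * f k y * ENNReal.ofReal ((∫ x in K, F.cocycle K x k ∂μ) ^ (β - γ))

/-- The orbit `(a_t x)_{t ≥ 0}` is `𝓕`-divergent on average: for all `k` and `M > 0`,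
`(1/T) ∫_0^T χ_{f_k ≤ M}(a_t x) dt → 0` as `T → ∞`. -/
def DivergentOnAverage {d : ℕ} {X : Type*} [MetricSpace X] [MulAction SL(d + 1, ℝ) X]
    (f : ℕ+ → X → ℝ≥0∞) (x : X) : Prop :=
  ∀ (k : ℕ+) (M : ℝ≥0), 0 < M →
    Tendsto (fun T : ℝ => (ENNReal.ofReal T)⁻¹ *
      ∫⁻ t in Set.Icc (0 : ℝ) T, {y : X | f k y ≤ M}.indicator (fun _ => (1 : ℝ≥0∞)) (aFlow d t • x))
      atTop (𝓝 0)

end FractalDivergence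

/-!
The dimension bound is a large deviation estimate for a random walk on words.

Write `h_ω = h_{ω_1} ∘ ⋯ ∘ h_{ω_n}` for a word `ω`. The identity `g_{ρ_i} u(h_i x) = diag(1, O_i)
u(x) q_i` (`IFS.gFlow_mul_uMat_map`), in which the element `q_i` does not depend on `x`, shows
that up to rotations commuting with the flow, and up to the bounded matrices `u(x)` with `x ∈ K`,
the orbit of `u(h_ω x) y` at the scale `ρ_ω` sits at `q_ω y`, where `q_ω = q_{ω_n} ⋯ q_{ω_1}`
(`IFS.exists_gFlow_mul_uMat_wordMap`). Since the functions `f_k` vary by bounded factors, the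
orbit only matters through the values `f_k (q_ω y)`.

Under the open set condition a limit set of dimension `s > 0` satisfies `∑ ρ_i ^ s = 1` and has
positive and finite `s`-dimensional Hausdorff measure (`IFS.IsLimitSet.dimension_formula`). The
upper bound is the covering by the pieces. The lower bound is the mass distribution principle for
the image of a Bernoulli measure, with a packing estimate for the words stopped at a given scale;
it only uses a ball in the open set, which may be unbounded. Consequently `μ(K̂_ω) = ρ_ω ^ s`, and
the contraction hypothesis becomes a discrete inequality: for `γ < β` and a suitable large `k`,
`∑_{ω ∈ Λ^k} ρ_ω ^ (s - γ) f_k (q_ω y) ≤ f_k(y) / 4` whenever `f_k(y)` exceeds a level `T`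
(`ContractionHypothesis.exists_contracting_power`). Here the constants of the hypothesis must not
depend on `k`, for the gain is the factor `(∫ ρ(x, k) dμ) ^ (β - γ)`, which tends to zero with
`k`.

From now on the words of length `k` are the letters of a new system, `IFS.power`. Iterating the
inequality, and discounting each visit below `T` by a fixed factor `2⁻ᵐ` that compensates for the
uncontrolled step there (`sum_prod_mul_pow_lowCount_le`), one finds that the words of length `n`
with at most `n / m` visits below `T` and with final height above `T` have total weight `O(2⁻ⁿ)`
for the weights `ρ_ω ^ (s - γ)` (`sum_sparse_le`). A point with an orbit divergent on average lies
in the pieces of such words for arbitrarily large `n` (`exists_sparseWord`), because each visit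
below `T` costs a fixed amount of time below a comparable level. Hence the set of these points is
null for the Hausdorff measure of dimension `s - γ` (`hausdorffMeasure_divergent_eq_zero`), and
`γ` tends to `β`.
-/

namespace FractalDivergence

/-! ### The matrices `g_r`, `u(x)` and the lift of a rotation -/

section Matrices

variable {d : ℕ}

/-- The block matrix `diag(1, O)`, for `O ∈ SO(d)`. -/
noncomputable def rotLift (O : Matrix (Fin d) (Fin d) ℝ)
    (hO : O ∈ Matrix.specialOrthogonalGroup (Fin d) ℝ) : SL(d + 1, ℝ) :=
  ⟨Matrix.of (Fin.cons (Fin.cons 1 fun _ => 0) fun i : Fin d => Fin.cons 0 fun j : Fin d => O i j),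
    by
      rw [Matrix.det_succ_column_zero, Fin.sum_univ_succ]
      have h : (Matrix.of (Fin.cons (Fin.cons 1 fun _ => 0)
          fun i : Fin d => Fin.cons 0 fun j : Fin d => O i j) :
            Matrix (Fin (d + 1)) (Fin (d + 1)) ℝ).submatrix (Fin.succAbove 0) Fin.succ = O := by
        ext i j
        simp
      rw [h, (Matrix.mem_specialOrthogonalGroup_iff.1 hO).2]
      simp⟩

@[simp] theorem rotLift_zero_zero (O : Matrix (Fin d) (Fin d) ℝ) (hO) :
    rotLift O hO 0 0 = 1 := rfl

@[simp] theorem rotLift_zero_succ (O : Matrix (Fin d) (Fin d) ℝ) (hO) (j : Fin d) :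
    rotLift O hO 0 j.succ = 0 := rfl

@[simp] theorem rotLift_succ_zero (O : Matrix (Fin d) (Fin d) ℝ) (hO) (i : Fin d) :
    rotLift O hO i.succ 0 = 0 := rfl

@[simp] theorem rotLift_succ_succ (O : Matrix (Fin d) (Fin d) ℝ) (hO) (i j : Fin d) :
    rotLift O hO i.succ j.succ = O i j := rfl

@[simp] theorem uMat_zero_zero (x : EuclideanSpace ℝ (Fin d)) : uMat x 0 0 = 1 := rfl

@[simp] theorem uMat_zero_succ (x : EuclideanSpace ℝ (Fin d)) (j : Fin d) :
    uMat x 0 j.succ = x j := rfl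

@[simp] theorem uMat_succ_zero (x : EuclideanSpace ℝ (Fin d)) (i : Fin d) :
    uMat x i.succ 0 = 0 := rfl

@[simp] theorem uMat_succ_succ (x : EuclideanSpace ℝ (Fin d)) (i j : Fin d) :
    uMat x i.succ j.succ = if i = j then 1 else 0 := rfl

theorem gFlow_apply {r : ℝ} (hr : 0 < r) (i j : Fin (d + 1)) :
    gFlow d r i j = if i = j then
      (Fin.cons (r ^ (-(d : ℝ) / (d + 1))) fun _ : Fin d => r ^ (1 / ((d : ℝ) + 1)) :
        Fin (d + 1) → ℝ) i else 0 := by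
  rw [gFlow, dif_pos hr]
  rfl

theorem aFlow_apply (t : ℝ) (i j : Fin (d + 1)) :
    aFlow d t i j = if i = j then
      (Fin.cons (Real.exp (d * t)) fun _ : Fin d => Real.exp (-t) : Fin (d + 1) → ℝ) i else 0 :=
  rfl

theorem rotLift_mem (O : Matrix (Fin d) (Fin d) ℝ)
    (hO : O ∈ Matrix.specialOrthogonalGroup (Fin d) ℝ) :
    (rotLift O hO : Matrix (Fin (d + 1)) (Fin (d + 1)) ℝ) ∈
      Matrix.specialOrthogonalGroup (Fin (d + 1)) ℝ := by
  refine Matrix.mem_specialOrthogonalGroup_iff.2 ⟨?_, (rotLift O hO).2⟩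
  have h := (Matrix.mem_orthogonalGroup_iff (Fin d) ℝ).1
    (Matrix.mem_specialOrthogonalGroup_iff.1 hO).1
  rw [Matrix.mem_orthogonalGroup_iff]
  ext i j
  refine Fin.cases ?_ (fun i => ?_) i <;> refine Fin.cases ?_ (fun j => ?_) j
  · simp [Matrix.mul_apply, Fin.sum_univ_succ]
  · simp [Matrix.mul_apply, Fin.sum_univ_succ, (Fin.succ_ne_zero j).symm]
  · simp [Matrix.mul_apply, Fin.sum_univ_succ]
  · simpa [Matrix.mul_apply, Fin.sum_univ_succ, Matrix.one_apply]
      using congrFun (congrFun h i) j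

theorem uMat_add (x y : EuclideanSpace ℝ (Fin d)) : uMat (x + y) = uMat x * uMat y := by
  ext i j
  refine Fin.cases ?_ (fun i => ?_) i <;> refine Fin.cases ?_ (fun j => ?_) j <;>
    simp [Matrix.SpecialLinearGroup.coe_mul, Matrix.mul_apply, Fin.sum_univ_succ, add_comm]

theorem gFlow_mul_uMat_smul {r : ℝ} (hr : 0 < r) (x : EuclideanSpace ℝ (Fin d)) :
    gFlow d r * uMat (r • x) = uMat x * gFlow d r := by
  have key : r ^ (-(d : ℝ) / (d + 1)) * r = r ^ (1 / ((d : ℝ) + 1)) := by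
    rw [← Real.rpow_add_one hr.ne']
    congr 1
    field_simp
    ring
  ext i j
  refine Fin.cases ?_ (fun i => ?_) i <;> refine Fin.cases ?_ (fun j => ?_) j <;>
    simp [Matrix.SpecialLinearGroup.coe_mul, Matrix.mul_apply, gFlow_apply hr,
      ← mul_assoc, key]
  simp [mul_comm]

theorem rotLift_mul_uMat (O : Matrix (Fin d) (Fin d) ℝ)
    (hO : O ∈ Matrix.specialOrthogonalGroup (Fin d) ℝ) (x : EuclideanSpace ℝ (Fin d)) :
    rotLift O hO * uMat x = uMat (Matrix.toEuclideanLin O x) * rotLift O hO := by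
  have h : O.transpose * O = 1 := (Matrix.mem_orthogonalGroup_iff' (Fin d) ℝ).1
    (Matrix.mem_specialOrthogonalGroup_iff.1 hO).1
  have h2 : ∀ j, ∑ i, (Matrix.toEuclideanLin O x) i * O i j = x j := by
    intro j
    have : (Matrix.vecMul (Matrix.mulVec O x.ofLp) O) j = x j := by
      rw [← Matrix.mulVec_transpose, Matrix.mulVec_mulVec, h, Matrix.one_mulVec]
    simpa [Matrix.vecMul, dotProduct] using this
  ext i j
  refine Fin.cases ?_ (fun i => ?_) i <;> refine Fin.cases ?_ (fun j => ?_) j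
  · simp [Matrix.SpecialLinearGroup.coe_mul, Matrix.mul_apply, Fin.sum_univ_succ]
  · simpa [Matrix.SpecialLinearGroup.coe_mul, Matrix.mul_apply, Fin.sum_univ_succ]
      using (h2 j).symm
  · simp [Matrix.SpecialLinearGroup.coe_mul, Matrix.mul_apply, Fin.sum_univ_succ]
  · simp [Matrix.SpecialLinearGroup.coe_mul, Matrix.mul_apply, Fin.sum_univ_succ]

theorem gFlow_mul_rotLift (O : Matrix (Fin d) (Fin d) ℝ)
    (hO : O ∈ Matrix.specialOrthogonalGroup (Fin d) ℝ) {r : ℝ} (hr : 0 < r) :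
    gFlow d r * rotLift O hO = rotLift O hO * gFlow d r := by
  ext i j
  refine Fin.cases ?_ (fun i => ?_) i <;> refine Fin.cases ?_ (fun j => ?_) j <;>
    simp [Matrix.SpecialLinearGroup.coe_mul, Matrix.mul_apply, gFlow_apply hr, mul_comm]

theorem gFlow_mul {r r' : ℝ} (hr : 0 < r) (hr' : 0 < r') :
    gFlow d (r * r') = gFlow d r * gFlow d r' := by
  ext i j
  refine Fin.cases ?_ (fun i => ?_) i <;> refine Fin.cases ?_ (fun j => ?_) j <;>
    simp [Matrix.SpecialLinearGroup.coe_mul, Matrix.mul_apply, gFlow_apply hr, gFlow_apply hr',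
      gFlow_apply (mul_pos hr hr'), (Fin.succ_ne_zero _).symm, Real.mul_rpow hr.le hr'.le]

theorem gFlow_one : gFlow d 1 = 1 := by
  ext i j
  refine Fin.cases ?_ (fun i => ?_) i <;> refine Fin.cases ?_ (fun j => ?_) j <;>
    simp [gFlow_apply one_pos, Matrix.one_apply]

theorem aFlow_add (t t' : ℝ) : aFlow d (t + t') = aFlow d t * aFlow d t' := by
  ext i j
  refine Fin.cases ?_ (fun i => ?_) i <;> refine Fin.cases ?_ (fun j => ?_) j <;>
    simp [Matrix.SpecialLinearGroup.coe_mul, Matrix.mul_apply, aFlow_apply,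
      (Fin.succ_ne_zero _).symm, ← Real.exp_add, mul_add, add_comm]

/-- The flows `a_t` and `g_r` agree under the change of time `r = e^{-(d+1)t}`. -/
theorem aFlow_neg_log_div {r : ℝ} (hr : 0 < r) :
    aFlow d (-Real.log r / (d + 1)) = gFlow d r := by
  have h1 : (d : ℝ) * (-Real.log r / (d + 1)) = Real.log r * (-(d : ℝ) / (d + 1)) := by ring
  have h2 : -(-Real.log r / ((d : ℝ) + 1)) = Real.log r * (1 / ((d : ℝ) + 1)) := by ring
  ext i j
  rw [aFlow_apply, gFlow_apply hr, h1, h2, Real.rpow_def_of_pos hr, Real.rpow_def_of_pos hr]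

/-- A set of matrices is bounded when the absolute values of their entries are. -/
def EntriesBounded (S : Set SL(d + 1, ℝ)) : Prop := ∃ R : ℝ, ∀ g ∈ S, ∀ i j, |g i j| ≤ R

theorem entriesBounded_of_isCompact {Y : Type*} [TopologicalSpace Y] {K : Set Y} (hK : IsCompact K)
    {φ : Y → SL(d + 1, ℝ)} (hφ : ∀ i j, ContinuousOn (fun y => φ y i j) K) :
    EntriesBounded (φ '' K) := by
  have : ∀ i j, ∃ R, ∀ y ∈ K, |φ y i j| ≤ R := by
    intro i j
    obtain ⟨R, hR⟩ := hK.exists_bound_of_continuousOn (hφ i j)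
    exact ⟨R, fun y hy => by simpa using hR y hy⟩
  choose R hR using this
  refine ⟨∑ i, ∑ j, |R i j|, ?_⟩
  rintro _ ⟨y, hy, rfl⟩ i j
  calc |φ y i j| ≤ |R i j| := (hR i j y hy).trans (le_abs_self _)
    _ ≤ ∑ j, |R i j| := Finset.single_le_sum (f := fun j => |R i j|)
        (fun _ _ => abs_nonneg _) (Finset.mem_univ j)
    _ ≤ ∑ i, ∑ j, |R i j| := Finset.single_le_sum (f := fun i => ∑ j, |R i j|)
        (fun _ _ => Finset.sum_nonneg fun _ _ => abs_nonneg _) (Finset.mem_univ i)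

theorem entriesBounded_finite {S : Set SL(d + 1, ℝ)} (hS : S.Finite) : EntriesBounded S := by
  let _ : TopologicalSpace SL(d + 1, ℝ) := ⊥
  have : DiscreteTopology SL(d + 1, ℝ) := ⟨rfl⟩
  simpa using entriesBounded_of_isCompact (φ := id) hS.isCompact
    (fun i j => continuous_of_discreteTopology.continuousOn)

theorem entriesBounded_uMat {K : Set (EuclideanSpace ℝ (Fin d))} (hK : IsCompact K) :
    EntriesBounded (uMat '' K) := by
  refine entriesBounded_of_isCompact hK fun i j => Continuous.continuousOn ?_
  refine Fin.cases ?_ (fun i => ?_) i <;> refine Fin.cases ?_ (fun j => ?_) j <;>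
    simp only [uMat_zero_zero, uMat_zero_succ, uMat_succ_zero, uMat_succ_succ] <;> fun_prop

theorem entriesBounded_aFlow (a b : ℝ) : EntriesBounded (aFlow d '' Set.Icc a b) := by
  refine entriesBounded_of_isCompact isCompact_Icc fun i j => Continuous.continuousOn ?_
  by_cases h : i = j
  · subst h
    refine Fin.cases ?_ (fun i => ?_) i <;>
      simp only [aFlow_apply, if_true, Fin.cons_zero, Fin.cons_succ] <;> fun_prop
  · simp only [aFlow_apply, h, if_false]
    fun_prop

/-- Every set of matrices with bounded entries lies in a neighbourhood of `1` with the same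
property. -/
theorem EntriesBounded.exists_nhds {S : Set SL(d + 1, ℝ)} (hS : EntriesBounded S) :
    ∃ O ∈ 𝓝 (1 : SL(d + 1, ℝ)), S ⊆ O ∧ EntriesBounded O := by
  obtain ⟨R, hR⟩ := hS
  refine ⟨{g | ∀ i j, |g i j| ≤ max R 2}, ?_, fun g hg i j => (hR g hg i j).trans (le_max_left _ _),
    max R 2, fun g hg => hg⟩
  have h : ∀ i j, ∀ᶠ g : SL(d + 1, ℝ) in 𝓝 1, |g i j| ≤ max R 2 := by
    intro i j
    have hc : Continuous fun g : SL(d + 1, ℝ) => |g i j| :=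
      ((continuous_apply_apply i j).comp
        (continuous_subtype_val : Continuous fun g : SL(d + 1, ℝ) =>
          (g : Matrix (Fin (d + 1)) (Fin (d + 1)) ℝ))).abs
    have h1 : |(1 : SL(d + 1, ℝ)) i j| < max R 2 := by
      refine lt_of_lt_of_le ?_ (le_max_right _ _)
      by_cases h : i = j <;> simp [h]
    exact (hc.continuousAt.eventually_lt continuousAt_const h1).mono fun _ h => h.le
  simpa [eventually_all, Filter.Eventually] using eventually_all.2 fun i => eventually_all.2 (h i)

end Matrices

/-! ### Words in an iterated function system -/

namespace IFS

variable {d : ℕ} {Λ : Type*}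

theorem norm_toEuclideanLin_of_mem {O : Matrix (Fin d) (Fin d) ℝ}
    (hO : O ∈ Matrix.specialOrthogonalGroup (Fin d) ℝ) (x : EuclideanSpace ℝ (Fin d)) :
    ‖Matrix.toEuclideanLin O x‖ = ‖x‖ := by
  have h : O.transpose * O = 1 := (Matrix.mem_orthogonalGroup_iff' (Fin d) ℝ).1
    (Matrix.mem_specialOrthogonalGroup_iff.1 hO).1
  have h2 : Matrix.mulVec O x.ofLp ⬝ᵥ Matrix.mulVec O x.ofLp = x.ofLp ⬝ᵥ x.ofLp := by
    rw [Matrix.dotProduct_mulVec, ← Matrix.mulVec_transpose, Matrix.mulVec_mulVec, h,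
      Matrix.one_mulVec]
  rw [EuclideanSpace.norm_eq, EuclideanSpace.norm_eq]
  congr 1
  simpa [dotProduct, sq] using h2

theorem dist_map (F : IFS d Λ) (i : Λ) (x y : EuclideanSpace ℝ (Fin d)) :
    dist (F.map i x) (F.map i y) = F.ratio i * dist x y := by
  rw [map, map, dist_add_right, dist_eq_norm, ← smul_sub, ← map_sub, norm_smul,
    norm_toEuclideanLin_of_mem (F.rot_mem i), Real.norm_of_nonneg (F.ratio_pos i).le,
    dist_eq_norm]

theorem wordRatio_succ (F : IFS d Λ) {n : ℕ} (ω : Fin (n + 1) → Λ) :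
    F.wordRatio ω = F.ratio (ω 0) * F.wordRatio (Fin.tail ω) :=
  Fin.prod_univ_succ _

theorem wordRatio_pos (F : IFS d Λ) {n : ℕ} (ω : Fin n → Λ) : 0 < F.wordRatio ω :=
  Finset.prod_pos fun _ _ => F.ratio_pos _

theorem dist_wordMap (F : IFS d Λ) {n : ℕ} (ω : Fin n → Λ) (x y : EuclideanSpace ℝ (Fin d)) :
    dist (F.wordMap n ω x) (F.wordMap n ω y) = F.wordRatio ω * dist x y := by
  induction n with
  | zero => simp [wordMap, wordRatio]
  | succ n ih =>
    rw [wordRatio_succ, mul_assoc, ← ih, ← dist_map]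
    rfl

theorem lipschitzWith_wordMap (F : IFS d Λ) {n : ℕ} (ω : Fin n → Λ) :
    LipschitzWith (F.wordRatio ω).toNNReal (F.wordMap n ω) :=
  LipschitzWith.of_dist_le_mul fun x y => by
    rw [dist_wordMap, Real.coe_toNNReal _ (F.wordRatio_pos ω).le]

/-- The largest contraction ratio is bounded away from one, and the smallest one from zero. -/
theorem exists_ratio_bounds [Finite Λ] (F : IFS d Λ) :
    ∃ a b : ℝ, 0 < a ∧ a < 1 ∧ 0 < b ∧ b < 1 ∧ ∀ i, a ≤ F.ratio i ∧ F.ratio i ≤ b := by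
  cases isEmpty_or_nonempty Λ with
  | inl h => exact ⟨1 / 2, 1 / 2, by norm_num, by norm_num, by norm_num, by norm_num,
      fun i => h.elim i⟩
  | inr h =>
    obtain ⟨i, hi⟩ := Finite.exists_min F.ratio
    obtain ⟨j, hj⟩ := Finite.exists_max F.ratio
    exact ⟨_, _, F.ratio_pos i, F.ratio_lt_one i, F.ratio_pos j, F.ratio_lt_one j,
      fun k => ⟨hi k, hj k⟩⟩

theorem wordRatio_le_pow (F : IFS d Λ) {b : ℝ} (hb : ∀ i, F.ratio i ≤ b) {n : ℕ}
    (ω : Fin n → Λ) : F.wordRatio ω ≤ b ^ n := by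
  simpa [wordRatio] using Finset.prod_le_prod (s := Finset.univ) (g := fun _ => b)
    (fun j _ => (F.ratio_pos (ω j)).le) fun j _ => hb (ω j)

theorem wordRatio_le_one (F : IFS d Λ) {n : ℕ} (ω : Fin n → Λ) : F.wordRatio ω ≤ 1 := by
  simpa using F.wordRatio_le_pow (fun i => (F.ratio_lt_one i).le) ω

theorem wordRatio_lt_one (F : IFS d Λ) {n : ℕ} (hn : n ≠ 0) (ω : Fin n → Λ) :
    F.wordRatio ω < 1 := by
  obtain ⟨m, rfl⟩ := Nat.exists_eq_succ_of_ne_zero hn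
  rw [wordRatio_succ]
  exact mul_lt_one_of_nonneg_of_lt_one_left (F.ratio_pos _).le (F.ratio_lt_one _)
    (F.wordRatio_le_one _)

/-- In particular, if `∑ ρ_i^t = 1`, then also `∑ ρ_ω^t = 1` over the words of any length. -/
theorem sum_wordRatio_rpow [Fintype Λ] (F : IFS d Λ) (t : ℝ) (n : ℕ) :
    ∑ ω : Fin n → Λ, F.wordRatio ω ^ t = (∑ i, F.ratio i ^ t) ^ n := by
  rw [← Fin.prod_const, Fintype.prod_sum]
  refine Finset.sum_congr rfl fun ω _ => ?_
  exact (Real.finsetProd_rpow _ _ (fun j _ => (F.ratio_pos (ω j)).le) t).symm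

/-- The product of the rotation parts along a word. -/
noncomputable def wordRot (F : IFS d Λ) :
    (n : ℕ) → (Fin n → Λ) → Matrix (Fin d) (Fin d) ℝ
  | 0, _ => 1
  | n + 1, ω => F.rot (ω 0) * wordRot F n (Fin.tail ω)

theorem wordRot_mem (F : IFS d Λ) {n : ℕ} (ω : Fin n → Λ) :
    F.wordRot n ω ∈ Matrix.specialOrthogonalGroup (Fin d) ℝ := by
  induction n with
  | zero => exact one_mem _
  | succ n ih => exact mul_mem (F.rot_mem _) (ih _)

theorem wordMap_eq (F : IFS d Λ) {n : ℕ} (ω : Fin n → Λ) (x : EuclideanSpace ℝ (Fin d)) :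
    F.wordMap n ω x =
      F.wordRatio ω • Matrix.toEuclideanLin (F.wordRot n ω) x + F.wordMap n ω 0 := by
  induction n with
  | zero => simp [wordMap, wordRatio, wordRot]
  | succ n ih =>
    have h : ∀ y, F.wordMap (n + 1) ω y = F.map (ω 0) (F.wordMap n (Fin.tail ω) y) := fun _ => rfl
    rw [h, h, ih, map, map, wordRatio_succ, wordRot, map_add, smul_add, map_smul, smul_smul,
      add_assoc]
    congr 2
    simp [Matrix.toLpLin_apply, Matrix.mulVec_mulVec]

/-- The iterated function system of all compositions of `k` maps of `F`. -/
noncomputable def power (F : IFS d Λ) (k : ℕ+) : IFS d (Fin k → Λ) where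
  ratio ω := F.wordRatio ω
  rot ω := F.wordRot k ω
  trans ω := F.wordMap k ω 0
  ratio_pos ω := F.wordRatio_pos ω
  ratio_lt_one ω := F.wordRatio_lt_one k.ne_zero ω
  rot_mem ω := F.wordRot_mem ω

theorem map_power (F : IFS d Λ) (k : ℕ+) (ω : Fin k → Λ) :
    (F.power k).map ω = F.wordMap k ω :=
  funext fun x => (F.wordMap_eq ω x).symm

theorem IsLimitSet.map_mem {F : IFS d Λ} {K : Set (EuclideanSpace ℝ (Fin d))}
    (hK : F.IsLimitSet K) (i : Λ) {x : EuclideanSpace ℝ (Fin d)} (hx : x ∈ K) :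
    F.map i x ∈ K := by
  rw [hK.eq_iUnion]
  exact Set.mem_iUnion.2 ⟨i, x, hx, rfl⟩

theorem IsLimitSet.exists_map {F : IFS d Λ} {K : Set (EuclideanSpace ℝ (Fin d))}
    (hK : F.IsLimitSet K) {x : EuclideanSpace ℝ (Fin d)} (hx : x ∈ K) :
    ∃ i, ∃ y ∈ K, F.map i y = x := by
  rw [hK.eq_iUnion] at hx
  simpa using hx

theorem IsLimitSet.wordMap_mem {F : IFS d Λ} {K : Set (EuclideanSpace ℝ (Fin d))}
    (hK : F.IsLimitSet K) {n : ℕ} (ω : Fin n → Λ) {x : EuclideanSpace ℝ (Fin d)} (hx : x ∈ K) :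
    F.wordMap n ω x ∈ K := by
  induction n with
  | zero => exact hx
  | succ n ih => exact hK.map_mem _ (ih _)

theorem IsLimitSet.exists_wordMap {F : IFS d Λ} {K : Set (EuclideanSpace ℝ (Fin d))}
    (hK : F.IsLimitSet K) (n : ℕ) {x : EuclideanSpace ℝ (Fin d)} (hx : x ∈ K) :
    ∃ ω : Fin n → Λ, ∃ y ∈ K, F.wordMap n ω y = x := by
  induction n generalizing x with
  | zero => exact ⟨Fin.elim0, x, hx, rfl⟩
  | succ n ih =>
    obtain ⟨i, y, hy, rfl⟩ := hK.exists_map hx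
    obtain ⟨ω, z, hz, rfl⟩ := ih hy
    exact ⟨Fin.cons i ω, z, hz, by simp [wordMap]⟩

theorem IsLimitSet.isCompact_piece {F : IFS d Λ} {K : Set (EuclideanSpace ℝ (Fin d))}
    (hK : F.IsLimitSet K) {n : ℕ} (ω : Fin n → Λ) : IsCompact (F.piece K ω) :=
  hK.isCompact.image (F.lipschitzWith_wordMap ω).continuous

theorem IsLimitSet.iUnion_piece {F : IFS d Λ} {K : Set (EuclideanSpace ℝ (Fin d))}
    (hK : F.IsLimitSet K) (n : ℕ) : ⋃ ω : Fin n → Λ, F.piece K ω = K := by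
  refine Set.Subset.antisymm (Set.iUnion_subset ?_) fun x hx => ?_
  · rintro ω _ ⟨x, hx, rfl⟩
    exact hK.wordMap_mem ω hx
  · obtain ⟨ω, y, hy, rfl⟩ := hK.exists_wordMap n hx
    exact Set.mem_iUnion.2 ⟨ω, y, hy, rfl⟩

theorem IsLimitSet.power {F : IFS d Λ} {K : Set (EuclideanSpace ℝ (Fin d))}
    (hK : F.IsLimitSet K) (k : ℕ+) : (F.power k).IsLimitSet K where
  isCompact := hK.isCompact
  nonempty := hK.nonempty
  eq_iUnion := by
    simp only [map_power]
    exact (hK.iUnion_piece k).symm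

theorem ediam_piece_le (F : IFS d Λ) (K : Set (EuclideanSpace ℝ (Fin d))) {n : ℕ}
    (ω : Fin n → Λ) :
    Metric.ediam (F.piece K ω) ≤ ENNReal.ofReal (F.wordRatio ω) * Metric.ediam K :=
  (F.lipschitzWith_wordMap ω).ediam_image_le K

/-! ### The group elements attached to the maps -/

/-- The element `q_i = diag(1, O_i)⁻¹ g_{ρ_i} u(b_i)`; the renormalised point `g_{ρ_i} u(h_i x) y`
is a rotation of `u(x) q_i y`. -/
noncomputable def stepElt (F : IFS d Λ) (i : Λ) : SL(d + 1, ℝ) :=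
  (rotLift (F.rot i) (F.rot_mem i))⁻¹ * gFlow d (F.ratio i) * uMat (F.trans i)

theorem gFlow_mul_uMat_map (F : IFS d Λ) (i : Λ) (x : EuclideanSpace ℝ (Fin d)) :
    gFlow d (F.ratio i) * uMat (F.map i x) =
      rotLift (F.rot i) (F.rot_mem i) * uMat x * F.stepElt i := by
  rw [map, uMat_add, ← mul_assoc, gFlow_mul_uMat_smul (F.ratio_pos i), rotLift_mul_uMat, stepElt]
  group

/-- The product `q_{ω_n} ⋯ q_{ω_1}` along a word; later letters act on the left. -/
noncomputable def wordElt (F : IFS d Λ) : (n : ℕ) → (Fin n → Λ) → SL(d + 1, ℝ)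
  | 0, _ => 1
  | n + 1, ω => wordElt F n (Fin.tail ω) * F.stepElt (ω 0)

/-- Renormalising at the scale of a word `ω` replaces `u(h_ω x)` by `u(x)` and the base point `y` by
`q_ω y`, up to a rotation commuting with the flow. -/
theorem exists_gFlow_mul_uMat_wordMap (F : IFS d Λ) {n : ℕ} (ω : Fin n → Λ) :
    ∃ m : SL(d + 1, ℝ), (m : Matrix (Fin (d + 1)) (Fin (d + 1)) ℝ) ∈
        Matrix.specialOrthogonalGroup (Fin (d + 1)) ℝ ∧
      (∀ r, 0 < r → gFlow d r * m = m * gFlow d r) ∧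
      ∀ x, gFlow d (F.wordRatio ω) * uMat (F.wordMap n ω x) = m * uMat x * F.wordElt n ω := by
  induction n with
  | zero => exact ⟨1, one_mem _, by simp, fun x => by simp [wordRatio, gFlow_one, wordMap, wordElt]⟩
  | succ n ih =>
    obtain ⟨m, hm, hcomm, h⟩ := ih (Fin.tail ω)
    set m₀ := rotLift (F.rot (ω 0)) (F.rot_mem (ω 0)) with hm₀
    have hcomm₀ : ∀ r, 0 < r → gFlow d r * m₀ = m₀ * gFlow d r :=
      fun r hr => gFlow_mul_rotLift _ _ hr
    refine ⟨m₀ * m, ?_, fun r hr => ?_, fun x => ?_⟩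
    · rw [Matrix.SpecialLinearGroup.coe_mul]
      exact mul_mem (rotLift_mem _ _) hm
    · rw [← mul_assoc, hcomm₀ r hr, mul_assoc, hcomm r hr, mul_assoc]
    · have h0 : F.wordMap (n + 1) ω x = F.map (ω 0) (F.wordMap n (Fin.tail ω) x) := rfl
      rw [wordRatio_succ, mul_comm, gFlow_mul (F.wordRatio_pos _) (F.ratio_pos _), h0, mul_assoc,
        gFlow_mul_uMat_map, ← hm₀, ← mul_assoc, ← mul_assoc, hcomm₀ _ (F.wordRatio_pos _),
        mul_assoc m₀, h, wordElt]
      simp only [mul_assoc]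

end IFS

/-! ### Height functions along coded orbits -/

section Heights

variable {d : ℕ} {Λ X : Type*} [MulAction SL(d + 1, ℝ) X]

/-- A function on `X` is a height if it is invariant under rotations and each bounded set of
matrices increases it by at most a bounded factor. -/
structure IsHeight (d : ℕ) {X : Type*} [MulAction SL(d + 1, ℝ) X] (f : X → ℝ≥0∞) : Prop where
  rot_invariant : ∀ (g : SL(d + 1, ℝ)) x, (g : Matrix (Fin (d + 1)) (Fin (d + 1)) ℝ) ∈
    Matrix.specialOrthogonalGroup (Fin (d + 1)) ℝ → f (g • x) = f x
  le_mul : ∀ S : Set SL(d + 1, ℝ), EntriesBounded S → ∃ C : ℝ≥0, 1 ≤ C ∧ ∀ g ∈ S, ∀ x,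
    f (g • x) ≤ C * f x

open Classical in
/-- The number of proper prefixes `v` of the word `ω` with `f (q_v y) ≤ T`. -/
noncomputable def lowCount (F : IFS d Λ) (f : X → ℝ≥0∞) (T : ℝ≥0∞) :
    (n : ℕ) → (Fin n → Λ) → X → ℕ
  | 0, _, _ => 0
  | n + 1, ω, y => (if f y ≤ T then 1 else 0) + lowCount F f T n (Fin.tail ω) (F.stepElt (ω 0) • y)

/-- If a step contracts `f` on average by `η` above the level `T`, and by `η / κ` everywhere, then
the weighted sum of `f` over the words of length `n`, discounted by `κ` for each visit below `T`,
decays like `η ^ n`. -/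
theorem sum_prod_mul_pow_lowCount_le [Fintype Λ] (F : IFS d Λ) (f : X → ℝ≥0∞) (T : ℝ≥0∞)
    (w : Λ → ℝ≥0∞) (η κ : ℝ≥0∞)
    (hhigh : ∀ y, T < f y → ∑ i, w i * f (F.stepElt i • y) ≤ η * f y)
    (hlow : ∀ y, κ * ∑ i, w i * f (F.stepElt i • y) ≤ η * f y) (n : ℕ) (y : X) :
    ∑ ω : Fin n → Λ, (∏ j, w (ω j)) * f (F.wordElt n ω • y) * κ ^ lowCount F f T n ω y ≤
      η ^ n * f y := by
  induction n generalizing y with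
  | zero => simp [IFS.wordElt, lowCount]
  | succ n ih =>
    rw [← (Fin.consEquiv fun _ => Λ).sum_comp, Fintype.sum_prod_type]
    set e : ℕ := if f y ≤ T then 1 else 0 with he
    have hstep : ∀ i, ∑ ω : Fin n → Λ, (∏ j, w ((Fin.cons i ω : Fin (n + 1) → Λ) j)) *
        f (F.wordElt (n + 1) (Fin.cons i ω) • y) * κ ^ lowCount F f T (n + 1) (Fin.cons i ω) y ≤
        κ ^ e * (w i * (η ^ n * f (F.stepElt i • y))) := by
      intro i
      refine le_trans (le_of_eq ?_) (mul_le_mul_right (mul_le_mul_right (ih (F.stepElt i • y)) _) _)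
      rw [Finset.mul_sum, Finset.mul_sum]
      refine Finset.sum_congr rfl fun ω _ => ?_
      simp only [Fin.prod_univ_succ, Fin.cons_zero, Fin.cons_succ, IFS.wordElt, lowCount,
        Fin.tail_cons, pow_add, mul_smul]
      rw [← he]
      ring
    refine (Finset.sum_le_sum fun i _ => hstep i).trans ?_
    rw [← Finset.mul_sum]
    have h1 : ∑ i, w i * (η ^ n * f (F.stepElt i • y)) =
        η ^ n * ∑ i, w i * f (F.stepElt i • y) := by
      rw [Finset.mul_sum]
      exact Finset.sum_congr rfl fun i _ => by ring
    rw [h1, pow_succ, mul_assoc, mul_left_comm]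
    refine mul_le_mul_right ?_ _
    by_cases hy : f y ≤ T
    · simpa [he, hy] using hlow y
    · simpa [he, hy] using hhigh y (not_le.1 hy)

/-- The word formed by the first `n` letters of a sequence. -/
def wordPrefix (a : ℕ → Λ) (n : ℕ) : Fin n → Λ := fun j => a j

theorem tail_wordPrefix (a : ℕ → Λ) (n : ℕ) :
    Fin.tail (wordPrefix a (n + 1)) = wordPrefix (fun j => a (j + 1)) n := rfl

theorem wordMap_wordPrefix (F : IFS d Λ) (a : ℕ → Λ) (p : ℕ → EuclideanSpace ℝ (Fin d))
    (h : ∀ n, F.map (a n) (p (n + 1)) = p n) (n : ℕ) :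
    F.wordMap n (wordPrefix a n) (p n) = p 0 := by
  induction n generalizing a p with
  | zero => rfl
  | succ n ih =>
    have := ih (fun j => a (j + 1)) (fun j => p (j + 1)) fun j => h (j + 1)
    rw [IFS.wordMap, Function.comp_apply, tail_wordPrefix, this]
    exact h 0

theorem wordRatio_wordPrefix_succ (F : IFS d Λ) (a : ℕ → Λ) (n : ℕ) :
    F.wordRatio (wordPrefix a (n + 1)) = F.wordRatio (wordPrefix a n) * F.ratio (a n) :=
  Fin.prod_univ_castSucc _

open Classical in
theorem lowCount_wordPrefix (F : IFS d Λ) (f : X → ℝ≥0∞) (T : ℝ≥0∞) (a : ℕ → Λ) (n : ℕ) (y : X) :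
    lowCount F f T n (wordPrefix a n) y = ∑ j ∈ Finset.range n,
      if f (F.wordElt j (wordPrefix a j) • y) ≤ T then 1 else 0 := by
  induction n generalizing a y with
  | zero => simp [lowCount]
  | succ n ih =>
    rw [lowCount, tail_wordPrefix, ih, Finset.sum_range_succ', add_comm]
    congr 1
    · refine Finset.sum_congr rfl fun j _ => ?_
      rw [IFS.wordElt, tail_wordPrefix, mul_smul]
      rfl
    · simp [IFS.wordElt]

/-- Every point of the limit set has a coding by an infinite sequence of letters. -/
theorem IFS.IsLimitSet.exists_coding {F : IFS d Λ} {K : Set (EuclideanSpace ℝ (Fin d))}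
    (hK : F.IsLimitSet K) {x : EuclideanSpace ℝ (Fin d)} (hx : x ∈ K) :
    ∃ (a : ℕ → Λ) (p : ℕ → EuclideanSpace ℝ (Fin d)), p 0 = x ∧ (∀ n, p n ∈ K) ∧
      ∀ n, F.map (a n) (p (n + 1)) = p n := by
  choose i q hqK hq using fun z : K => hK.exists_map z.2
  let p : ℕ → K := fun n => (fun z => ⟨q z, hqK z⟩)^[n] ⟨x, hx⟩
  refine ⟨fun n => i (p n), fun n => p n, rfl, fun n => (p n).2, fun n => ?_⟩
  have : p (n + 1) = ⟨q (p n), hqK (p n)⟩ := Function.iterate_succ_apply' _ _ _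
  beta_reduce
  rw [this]
  exact hq (p n)

/-- The time at which the flow `a_t` reaches the scale of the `n`-th prefix. -/
noncomputable def prefixTime (F : IFS d Λ) (a : ℕ → Λ) (n : ℕ) : ℝ :=
  -Real.log (F.wordRatio (wordPrefix a n)) / (d + 1)

theorem prefixTime_zero (F : IFS d Λ) (a : ℕ → Λ) : prefixTime F a 0 = 0 := by
  simp [prefixTime, IFS.wordRatio]

theorem prefixTime_succ (F : IFS d Λ) (a : ℕ → Λ) (n : ℕ) :
    prefixTime F a (n + 1) = prefixTime F a n + -Real.log (F.ratio (a n)) / (d + 1) := by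
  rw [prefixTime, prefixTime, wordRatio_wordPrefix_succ,
    Real.log_mul (F.wordRatio_pos _).ne' (F.ratio_pos _).ne']
  ring

theorem exists_step_bounds [Finite Λ] (F : IFS d Λ) :
    ∃ δ Δ : ℝ, 0 < δ ∧ 0 < Δ ∧ ∀ i, δ ≤ -Real.log (F.ratio i) / (d + 1) ∧
      -Real.log (F.ratio i) / (d + 1) ≤ Δ := by
  obtain ⟨a, b, ha, ha1, hb, hb1, h⟩ := F.exists_ratio_bounds
  have hd : (0 : ℝ) < d + 1 := by positivity
  refine ⟨-Real.log b / (d + 1), -Real.log a / (d + 1),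
    div_pos (neg_pos.2 (Real.log_neg hb hb1)) hd, div_pos (neg_pos.2 (Real.log_neg ha ha1)) hd,
    fun i => ⟨?_, ?_⟩⟩
  · have := Real.log_le_log (F.ratio_pos i) (h i).2
    gcongr
  · have := Real.log_le_log ha (h i).1
    gcongr

/-- Divergence on average for a single function `f`: the orbit of `y` spends a proportion zero of
its time in each sublevel set of `f`. -/
def DivergesFor (d : ℕ) {X : Type*} [MulAction SL(d + 1, ℝ) X] (f : X → ℝ≥0∞) (y : X) : Prop :=
  ∀ M : ℝ≥0, 0 < M →
    Tendsto (fun T : ℝ => (ENNReal.ofReal T)⁻¹ *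
      ∫⁻ t in Set.Icc (0 : ℝ) T, {z : X | f z ≤ M}.indicator (fun _ => (1 : ℝ≥0∞)) (aFlow d t • y))
      atTop (𝓝 0)

/-- Along the coding of a point whose orbit diverges on average, the low prefixes have density
zero: a low prefix makes the flow stay below a comparable level during a time interval of fixed
length. -/
theorem eventually_mul_lowCount_le [Finite Λ] (F : IFS d Λ) {K : Set (EuclideanSpace ℝ (Fin d))}
    (hK : IsCompact K) {f : X → ℝ≥0∞} (hf : IsHeight d f) {T : ℝ≥0} (hT : 0 < T) (a : ℕ → Λ)
    (p : ℕ → EuclideanSpace ℝ (Fin d)) (hpK : ∀ n, p n ∈ K)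
    (hp : ∀ n, F.map (a n) (p (n + 1)) = p n) (y : X) (hdiv : DivergesFor d f (uMat (p 0) • y))
    (m : ℕ) : ∀ᶠ n in atTop, m * lowCount F f T n (wordPrefix a n) y ≤ n := by
  classical
  obtain ⟨δ, Δ, hδ, hΔ, hstep⟩ := exists_step_bounds F
  obtain ⟨C, hC, hCu⟩ := hf.le_mul _ (entriesBounded_uMat hK)
  obtain ⟨C', hC', hCa⟩ := hf.le_mul _ (entriesBounded_aFlow (d := d) 0 δ)
  have hM : 0 < C' * (C * T) :=
    mul_pos (zero_lt_one.trans_le hC') (mul_pos (zero_lt_one.trans_le hC) hT)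
  set M : ℝ≥0 := C' * (C * T) with hMdef
  set τ := prefixTime F a with hτ
  have hτ0 : τ 0 = 0 := prefixTime_zero F a
  have hτs : ∀ n, τ n + δ ≤ τ (n + 1) ∧ τ (n + 1) ≤ τ n + Δ := fun n => by
    rw [hτ, prefixTime_succ]
    exact ⟨by linarith [(hstep (a n)).1], by linarith [(hstep (a n)).2]⟩
  have hτl : ∀ n : ℕ, δ * n ≤ τ n := fun n => by
    induction n with
    | zero => simp [hτ0]
    | succ n ih => push_cast; linarith [(hτs n).1]
  have hτu : ∀ n : ℕ, τ n ≤ Δ * n := fun n => by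
    induction n with
    | zero => simp [hτ0]
    | succ n ih => push_cast; linarith [(hτs n).2]
  have hτnn : ∀ n, 0 ≤ τ n := fun n => (mul_nonneg hδ.le n.cast_nonneg).trans (hτl n)
  -- a low prefix forces the flow below the level `M` for a time `δ`
  have hlow : ∀ n, f (F.wordElt n (wordPrefix a n) • y) ≤ T → ∀ t ∈ Set.Ico (τ n) (τ n + δ),
      f (aFlow d t • uMat (p 0) • y) ≤ M := by
    intro n hn t ht
    obtain ⟨g, hg, -, hgx⟩ := F.exists_gFlow_mul_uMat_wordMap (wordPrefix a n)
    have h1 : aFlow d t • uMat (p 0) • y =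
        aFlow d (t - τ n) • g • uMat (p n) • F.wordElt n (wordPrefix a n) • y := by
      have h2 : aFlow d t = aFlow d (t - τ n) * gFlow d (F.wordRatio (wordPrefix a n)) := by
        rw [← aFlow_neg_log_div (F.wordRatio_pos _), ← aFlow_add, hτ, prefixTime]
        congr 1
        ring
      rw [h2, ← wordMap_wordPrefix F a p hp n, smul_smul, mul_assoc, hgx]
      simp only [mul_smul]
    rw [h1]
    refine (hCa _ ⟨t - τ n, ⟨by linarith [ht.1], by linarith [ht.2]⟩, rfl⟩ _).trans ?_
    rw [hf.rot_invariant g _ hg, hMdef, ENNReal.coe_mul, ENNReal.coe_mul]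
    gcongr
    exact (hCu _ ⟨p n, hpK n, rfl⟩ _).trans (by gcongr)
  set φ : ℝ → ℝ≥0∞ := fun t => {z : X | f z ≤ M}.indicator (fun _ => (1 : ℝ≥0∞))
    (aFlow d t • uMat (p 0) • y) with hφ
  have hint : ∀ n, ENNReal.ofReal δ * lowCount F f T n (wordPrefix a n) y ≤
      ∫⁻ t in Set.Ico 0 (τ n), φ t := by
    intro n
    rw [lowCount_wordPrefix]
    induction n with
    | zero => simp
    | succ n ih =>
      rw [Finset.sum_range_succ, Nat.cast_add, mul_add,
        ← Set.Ico_union_Ico_eq_Ico (hτnn n) (by linarith [(hτs n).1] : τ n ≤ τ (n + 1)),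
        lintegral_union measurableSet_Ico
          (Set.disjoint_left.2 fun t ht ht' => absurd ht.2 (not_lt.2 ht'.1))]
      refine add_le_add ih ?_
      split_ifs with hn
      · calc ENNReal.ofReal δ * ((1 : ℕ) : ℝ≥0∞)
            = ∫⁻ t in Set.Ico (τ n) (τ n + δ), 1 := by simp
          _ ≤ ∫⁻ t in Set.Ico (τ n) (τ n + δ), φ t := by
            refine setLIntegral_mono' measurableSet_Ico fun t ht => ?_
            have : aFlow d t • uMat (p 0) • y ∈ {z : X | f z ≤ M} := hlow n hn t ht
            rw [hφ]
            simp only [Set.indicator_of_mem this, le_refl]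
          _ ≤ ∫⁻ t in Set.Ico (τ n) (τ (n + 1)), φ t :=
            lintegral_mono_set (Set.Ico_subset_Ico_right (hτs n).1)
      · simp
  have hτtop : Tendsto τ atTop atTop :=
    tendsto_atTop_mono hτl (tendsto_natCast_atTop_atTop.const_mul_atTop hδ)
  have hε : 0 < δ / (Δ * (m + 1)) := by positivity
  have hev := ((hdiv M hM).comp hτtop).eventually
    (gt_mem_nhds (ENNReal.ofReal_pos.2 hε) : ∀ᶠ z in 𝓝 (0 : ℝ≥0∞), z < _)
  filter_upwards [hev, eventually_gt_atTop 0] with n hn hn0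
  have hτpos : 0 < τ n := lt_of_lt_of_le (mul_pos hδ (Nat.cast_pos.2 hn0)) (hτl n)
  have h1 : ∫⁻ t in Set.Icc 0 (τ n), φ t ≤ ENNReal.ofReal (δ / (Δ * (m + 1)) * τ n) := by
    rw [mul_comm, ENNReal.ofReal_mul hτpos.le]
    exact (ENNReal.inv_mul_le_iff (ENNReal.ofReal_pos.2 hτpos).ne' ENNReal.ofReal_ne_top).1 hn.le
  have h2 := (hint n).trans ((lintegral_mono_set Set.Ico_subset_Icc_self).trans h1)
  rw [← ENNReal.ofReal_natCast, ← ENNReal.ofReal_mul hδ.le,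
    ENNReal.ofReal_le_ofReal_iff (by positivity)] at h2
  set L : ℕ := lowCount F f T n (wordPrefix a n) y
  have h3 : δ * L ≤ δ / (Δ * (m + 1)) * (Δ * n) := h2.trans (by gcongr; exact hτu n)
  have h4 : δ / (Δ * (m + 1)) * (Δ * n) = δ * (n / (m + 1)) := by
    field_simp
  rw [h4] at h3
  have h5 := le_of_mul_le_mul_left h3 hδ
  rw [le_div_iff₀ (by positivity)] at h5
  have h6 : (L : ℝ) * m ≤ n := by nlinarith [(Nat.cast_nonneg L : (0 : ℝ) ≤ L)]
  have h7 : L * m ≤ n := by exact_mod_cast h6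
  rwa [mul_comm]

end Heights

/-! ### Covering the divergent points -/

section Covering

variable {d : ℕ} {Λ X : Type*} [MulAction SL(d + 1, ℝ) X]

theorem exists_sum_mul_le [Fintype Λ] (F : IFS d Λ) {f : X → ℝ≥0∞} (hf : IsHeight d f) {t : ℝ}
    (ht : 0 ≤ t) : ∃ B : ℝ≥0, ∀ y,
      ∑ i, ENNReal.ofReal (F.ratio i ^ t) * f (F.stepElt i • y) ≤ B * f y := by
  obtain ⟨C, -, hC⟩ := hf.le_mul _ (entriesBounded_finite (Set.finite_range F.stepElt))
  refine ⟨Fintype.card Λ * C, fun y => ?_⟩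
  calc ∑ i, ENNReal.ofReal (F.ratio i ^ t) * f (F.stepElt i • y)
      ≤ ∑ _i : Λ, 1 * (C * f y) := by
        refine Finset.sum_le_sum fun i _ => mul_le_mul' ?_ (hC _ ⟨i, rfl⟩ y)
        rw [← ENNReal.ofReal_one]
        exact ENNReal.ofReal_le_ofReal
          (Real.rpow_le_one (F.ratio_pos i).le (F.ratio_lt_one i).le ht)
    _ = ((Fintype.card Λ * C : ℝ≥0) : ℝ≥0∞) * f y := by
        simp [mul_assoc]

/-- A word is sparse if few of its prefixes are low and its last point is high. -/
def SparseWord (F : IFS d Λ) (f : X → ℝ≥0∞) (T : ℝ≥0∞) (m : ℕ) {n : ℕ} (ω : Fin n → Λ) (y : X) :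
    Prop :=
  m * lowCount F f T n ω y ≤ n ∧ T < f (F.wordElt n ω • y)

open Classical in
/-- If every step contracts `f` by `1/4` above the level `T`, the total weight of the sparse words
of length `n` is `O(2⁻ⁿ)`. -/
theorem sum_sparse_le [Fintype Λ] (F : IFS d Λ) {f : X → ℝ≥0∞} {T : ℝ≥0} (hT : 0 < T) {t : ℝ}
    {B : ℝ≥0} (hB : ∀ y, ∑ i, ENNReal.ofReal (F.ratio i ^ t) * f (F.stepElt i • y) ≤ B * f y)
    (hhigh : ∀ y, T < f y →
      ∑ i, ENNReal.ofReal (F.ratio i ^ t) * f (F.stepElt i • y) ≤ 4⁻¹ * f y)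
    {m : ℕ} (hm : 4 * B ≤ 2 ^ m) (n : ℕ) (y : X) :
    ∑ ω : Fin n → Λ, (if SparseWord F f T m ω y then ENNReal.ofReal (F.wordRatio ω ^ t) else 0) ≤
      (T : ℝ≥0∞)⁻¹ * f y * 2⁻¹ ^ n := by
  have h4 : (4 : ℝ≥0∞)⁻¹ = 2⁻¹ * 2⁻¹ := by
    rw [← ENNReal.mul_inv (by simp) (by simp)]; norm_num
  have h2 : (2 : ℝ≥0∞)⁻¹ * 2 = 1 := ENNReal.inv_mul_cancel (by simp) (by simp)
  -- the discount `2⁻ᵐ` per low prefix absorbs the uncontrolled growth `B` of a low step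
  have hκ : (2⁻¹ : ℝ≥0∞) ^ m * B ≤ 4⁻¹ := by
    have h : ((4 * B : ℝ≥0) : ℝ≥0∞) ≤ 2 ^ m := by exact_mod_cast hm
    calc (2⁻¹ : ℝ≥0∞) ^ m * B = 4⁻¹ * 4 * (2⁻¹ ^ m * B) := by
          rw [ENNReal.inv_mul_cancel (by simp) (by simp), one_mul]
      _ = 4⁻¹ * (2⁻¹ ^ m * ((4 * B : ℝ≥0) : ℝ≥0∞)) := by
          rw [ENNReal.coe_mul, ENNReal.coe_ofNat]
          ring
      _ ≤ 4⁻¹ * (2⁻¹ ^ m * 2 ^ m) := by gcongr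
      _ = 4⁻¹ := by rw [← mul_pow, h2, one_pow, mul_one]
  have key := sum_prod_mul_pow_lowCount_le F f T (fun i => ENNReal.ofReal (F.ratio i ^ t)) 4⁻¹
    (2⁻¹ ^ m) hhigh (fun y => by
      refine (mul_le_mul_right (hB y) _).trans ?_
      rw [← mul_assoc]
      gcongr) n y
  have hterm : ∀ ω : Fin n → Λ, T * 2⁻¹ ^ n *
      (if SparseWord F f T m ω y then ENNReal.ofReal (F.wordRatio ω ^ t) else 0) ≤
      (∏ j, ENNReal.ofReal (F.ratio (ω j) ^ t)) * f (F.wordElt n ω • y) *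
        (2⁻¹ ^ m) ^ lowCount F f T n ω y := by
    intro ω
    split_ifs with h
    · rw [← ENNReal.ofReal_prod_of_nonneg fun j _ => Real.rpow_nonneg (F.ratio_pos _).le _,
        Real.finsetProd_rpow _ _ fun j _ => (F.ratio_pos _).le, ← pow_mul, mul_comm _
        (ENNReal.ofReal _), mul_assoc]
      refine mul_le_mul' le_rfl (mul_le_mul' h.2.le ?_)
      exact pow_le_pow_right_of_le_one' (by simp) h.1
    · simp
  have h5 := (Finset.sum_le_sum fun ω (_ : ω ∈ Finset.univ) => hterm ω).trans key
  rw [← Finset.mul_sum, h4, mul_pow] at h5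
  set S := ∑ ω : Fin n → Λ,
    (if SparseWord F f T m ω y then ENNReal.ofReal (F.wordRatio ω ^ t) else 0)
  have hT0 : (T : ℝ≥0∞) ≠ 0 := by exact_mod_cast hT.ne'
  have h2n : (2⁻¹ : ℝ≥0∞) ^ n * 2 ^ n = 1 := by rw [← mul_pow, h2, one_pow]
  calc S = (T : ℝ≥0∞)⁻¹ * 2 ^ n * (T * 2⁻¹ ^ n * S) := by
        rw [mul_assoc (T : ℝ≥0∞), mul_mul_mul_comm, ENNReal.inv_mul_cancel hT0 ENNReal.coe_ne_top,
          ← mul_assoc (2 ^ n), mul_comm (2 ^ n), h2n, one_mul, one_mul]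
    _ ≤ (T : ℝ≥0∞)⁻¹ * 2 ^ n * (2⁻¹ ^ n * 2⁻¹ ^ n * f y) := by gcongr
    _ = (T : ℝ≥0∞)⁻¹ * f y * 2⁻¹ ^ n * (2⁻¹ ^ n * 2 ^ n) := by ring
    _ = (T : ℝ≥0∞)⁻¹ * f y * 2⁻¹ ^ n := by rw [h2n, mul_one]

/-- The coding of a divergent point has arbitrarily long sparse prefixes. -/
theorem exists_sparseWord [Finite Λ] (F : IFS d Λ) {K : Set (EuclideanSpace ℝ (Fin d))}
    (hK : F.IsLimitSet K) {f : X → ℝ≥0∞} (hf : IsHeight d f) {T : ℝ≥0} (hT : 0 < T) (y : X)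
    {x : EuclideanSpace ℝ (Fin d)} (hx : x ∈ K) (hdiv : DivergesFor d f (uMat x • y)) {m : ℕ}
    (hm : 2 ≤ m) (N : ℕ) :
    ∃ n, ∃ ω : Fin (N + n) → Λ, SparseWord F f T m ω y ∧ x ∈ F.piece K ω := by
  classical
  obtain ⟨a, p, rfl, hpK, hp⟩ := hK.exists_coding hx
  obtain ⟨N₀, hN₀⟩ := eventually_atTop.1
    (eventually_mul_lowCount_le F hK.isCompact hf hT a p hpK hp y hdiv m)
  by_contra! hcon
  have hlow : ∀ n, max N N₀ ≤ n → f (F.wordElt n (wordPrefix a n) • y) ≤ T := by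
    intro n hn
    obtain ⟨n, rfl⟩ := Nat.exists_eq_add_of_le (le_of_max_le_left hn)
    by_contra! hT'
    exact hcon n (wordPrefix a (N + n)) ⟨hN₀ _ (le_of_max_le_right hn), hT'⟩
      ⟨p (N + n), hpK _, wordMap_wordPrefix F a p hp _⟩
  -- all prefixes of length between `max N N₀` and its double would be low, more than half of them
  set n := max N N₀ with hn
  have h1 := hN₀ (n + (n + 1)) (le_trans (le_max_right _ _) (Nat.le_add_right n _))
  rw [lowCount_wordPrefix, Finset.sum_range_add] at h1
  have h2 : ∑ j ∈ Finset.range (n + 1), (if f (F.wordElt (n + j) (wordPrefix a (n + j)) • y) ≤ T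
      then 1 else 0) = n + 1 := by
    rw [Finset.sum_congr rfl fun j _ => if_pos (hlow (n + j) (Nat.le_add_right n j))]
    simp
  rw [h2] at h1
  nlinarith [Nat.zero_le (∑ j ∈ Finset.range n,
    if f (F.wordElt j (wordPrefix a j) • y) ≤ T then 1 else 0)]

/-- A one-step contraction by `1/4` with weights `ρ_i ^ t` makes the set of points with divergent
orbits null for the `t`-dimensional Hausdorff measure. -/
theorem hausdorffMeasure_divergent_eq_zero [Fintype Λ] (F : IFS d Λ)
    {K : Set (EuclideanSpace ℝ (Fin d))} (hK : F.IsLimitSet K) {f : X → ℝ≥0∞} (hf : IsHeight d f)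
    {T : ℝ≥0} (hT : 0 < T) {t : ℝ} (ht : 0 < t)
    (hhigh : ∀ y, T < f y →
      ∑ i, ENNReal.ofReal (F.ratio i ^ t) * f (F.stepElt i • y) ≤ 4⁻¹ * f y)
    (y : X) (hy : f y ≠ ∞) :
    Measure.hausdorffMeasure t {x | x ∈ K ∧ DivergesFor d f (uMat x • y)} = 0 := by
  classical
  obtain ⟨B, hB⟩ := exists_sum_mul_le F hf ht.le
  obtain ⟨m₀, hm₀⟩ := pow_unbounded_of_one_lt (4 * B) (one_lt_two : (1 : ℝ≥0) < 2)
  obtain ⟨m, hm, hm2⟩ : ∃ m, 4 * B ≤ 2 ^ m ∧ 2 ≤ m :=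
    ⟨max m₀ 2, hm₀.le.trans (pow_le_pow_right₀ one_le_two (le_max_left _ _)), le_max_right _ _⟩
  obtain ⟨a, b, -, -, hb, hb1, hab⟩ := F.exists_ratio_bounds
  set D := Metric.ediam K with hD
  have hDtop : D ≠ ∞ := hK.isCompact.isBounded.ediam_ne_top
  have hmeas := Measure.hausdorffMeasure_le_liminf_tsum
    (ι := fun N : ℕ => Σ n : ℕ, (Fin (N + n) → Λ)) (l := atTop) t
    {x | x ∈ K ∧ DivergesFor d f (uMat x • y)} (fun N => ENNReal.ofReal (b ^ N) * D) (by
      have : Tendsto (fun N : ℕ => ENNReal.ofReal (b ^ N) * D) atTop (𝓝 (ENNReal.ofReal 0 * D)) :=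
        ENNReal.Tendsto.mul_const (ENNReal.tendsto_ofReal
          (tendsto_pow_atTop_nhds_zero_of_lt_one hb.le hb1)) (Or.inr hDtop)
      simpa using this)
    (fun N ω => if SparseWord F f T m ω.2 y then F.piece K ω.2 else ∅)
    (Eventually.of_forall fun N ω => by
      split_ifs with h
      · refine (F.ediam_piece_le K ω.2).trans ?_
        gcongr
        exact (F.wordRatio_le_pow (fun i => (hab i).2) ω.2).trans
          (pow_le_pow_of_le_one hb.le hb1.le (Nat.le_add_right _ _))
      · simp)
    (Eventually.of_forall fun N x hx => by
      obtain ⟨n, ω, hω, hxω⟩ := exists_sparseWord F hK hf hT y hx.1 hx.2 hm2 N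
      exact Set.mem_iUnion.2 ⟨⟨n, ω⟩, by simpa [hω] using hxω⟩)
  have hsum : ∀ N : ℕ, ∑' ω : Σ n : ℕ, (Fin (N + n) → Λ),
      Metric.ediam (if SparseWord F f T m ω.2 y then F.piece K ω.2 else ∅) ^ t ≤
      D ^ t * ((T : ℝ≥0∞)⁻¹ * f y) * (2⁻¹ ^ N * 2) := by
    intro N
    rw [ENNReal.tsum_sigma']
    calc ∑' n : ℕ, ∑' ω : Fin (N + n) → Λ,
          Metric.ediam (if SparseWord F f T m ω y then F.piece K ω else ∅) ^ t
        ≤ ∑' n : ℕ, D ^ t * ((T : ℝ≥0∞)⁻¹ * f y * 2⁻¹ ^ (N + n)) := by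
          refine ENNReal.tsum_le_tsum fun n => ?_
          rw [tsum_fintype]
          refine le_trans ?_ (mul_le_mul_right (sum_sparse_le F hT hB hhigh hm (N + n) y) _)
          rw [Finset.mul_sum]
          refine Finset.sum_le_sum fun ω _ => ?_
          split_ifs with h
          · rw [mul_comm, ← ENNReal.ofReal_rpow_of_pos (F.wordRatio_pos ω),
              ← ENNReal.mul_rpow_of_nonneg _ _ ht.le]
            exact ENNReal.rpow_le_rpow (F.ediam_piece_le K ω) ht.le
          · simp [ht]
      _ = D ^ t * ((T : ℝ≥0∞)⁻¹ * f y) * (2⁻¹ ^ N * 2) := by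
          simp only [pow_add, ← mul_assoc]
          rw [ENNReal.tsum_mul_left, ENNReal.tsum_geometric, ENNReal.one_sub_inv_two, inv_inv]
  have hlim : Tendsto (fun N : ℕ => D ^ t * ((T : ℝ≥0∞)⁻¹ * f y) * (2⁻¹ ^ N * 2)) atTop (𝓝 0) := by
    have hc : D ^ t * ((T : ℝ≥0∞)⁻¹ * f y) ≠ ∞ :=
      ENNReal.mul_ne_top (ENNReal.rpow_ne_top_of_nonneg ht.le hDtop)
        (ENNReal.mul_ne_top (ENNReal.inv_ne_top.2 (by exact_mod_cast hT.ne')) hy)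
    have h := ENNReal.Tendsto.const_mul (a := D ^ t * ((T : ℝ≥0∞)⁻¹ * f y))
      (ENNReal.Tendsto.mul_const (b := 2) (ENNReal.tendsto_pow_atTop_nhds_zero_of_lt_one
        (r := 2⁻¹) (by simp)) (Or.inr (by simp))) (Or.inr hc)
    simpa using h
  refine le_antisymm (hmeas.trans ?_) zero_le
  rw [← hlim.liminf_eq]
  exact liminf_le_liminf (Eventually.of_forall hsum)

end Covering

/-! ### The dimension of the limit set under the open set condition -/

namespace IFS

section Hutchinson

variable {d : ℕ} {Λ : Type*}

/-- The similarity dimension exists. -/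
theorem exists_sum_ratio_rpow_eq_one [Fintype Λ] [Nonempty Λ] (F : IFS d Λ) :
    ∃ t : ℝ, 0 ≤ t ∧ ∑ i, F.ratio i ^ t = 1 := by
  obtain ⟨a, b, ha, ha1, hb, hb1, hab⟩ := F.exists_ratio_bounds
  have hcard : (0 : ℝ) < Fintype.card Λ := Nat.cast_pos.2 Fintype.card_pos
  obtain ⟨N, hN⟩ := exists_pow_lt_of_lt_one (inv_pos.2 hcard) hb1
  have hcont : Continuous fun t : ℝ => ∑ i, F.ratio i ^ t :=
    continuous_finsetSum _ fun i _ => Real.continuous_const_rpow (F.ratio_pos i).ne'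
  have h0 : (1 : ℝ) ≤ ∑ i, F.ratio i ^ (0 : ℝ) := by
    simpa using (Nat.one_le_cast (α := ℝ)).2 (Fintype.card_pos (α := Λ))
  have h1 : ∑ i, F.ratio i ^ (N : ℝ) ≤ 1 := by
    calc ∑ i, F.ratio i ^ (N : ℝ) ≤ ∑ _i : Λ, (Fintype.card Λ : ℝ)⁻¹ := by
          refine Finset.sum_le_sum fun i _ => ?_
          rw [Real.rpow_natCast]
          exact (pow_le_pow_left₀ (F.ratio_pos i).le (hab i).2 N).trans hN.le
      _ = 1 := by simp [hcard.ne']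
  obtain ⟨t, ht, hsum⟩ := intermediate_value_Icc' (Nat.cast_nonneg N) hcont.continuousOn ⟨h1, h0⟩
  exact ⟨t, ht.1, hsum⟩

theorem IsLimitSet.hausdorffMeasure_ne_top [Fintype Λ] {F : IFS d Λ}
    {K : Set (EuclideanSpace ℝ (Fin d))} (hK : F.IsLimitSet K) {t : ℝ} (ht : 0 ≤ t)
    (hsum : ∑ i, F.ratio i ^ t = 1) : Measure.hausdorffMeasure t K ≠ ∞ := by
  obtain ⟨a, b, -, -, hb, hb1, hab⟩ := F.exists_ratio_bounds
  have hDtop : Metric.ediam K ≠ ∞ := hK.isCompact.isBounded.ediam_ne_top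
  have h := Measure.hausdorffMeasure_le_liminf_sum
    (ι := fun n : ℕ => Fin n → Λ) (l := atTop) t K
    (fun n => ENNReal.ofReal (b ^ n) * Metric.ediam K) (by
      have : Tendsto (fun N : ℕ => ENNReal.ofReal (b ^ N) * Metric.ediam K) atTop
          (𝓝 (ENNReal.ofReal 0 * Metric.ediam K)) :=
        ENNReal.Tendsto.mul_const (ENNReal.tendsto_ofReal
          (tendsto_pow_atTop_nhds_zero_of_lt_one hb.le hb1)) (Or.inr hDtop)
      simpa using this)
    (fun n ω => F.piece K ω)
    (Eventually.of_forall fun n ω => by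
      refine (F.ediam_piece_le K ω).trans ?_
      gcongr
      exact F.wordRatio_le_pow (fun i => (hab i).2) ω)
    (Eventually.of_forall fun n => (hK.iUnion_piece n).ge)
  have hle : ∀ n : ℕ, ∑ ω : Fin n → Λ, Metric.ediam (F.piece K ω) ^ t ≤ Metric.ediam K ^ t := by
    intro n
    calc ∑ ω : Fin n → Λ, Metric.ediam (F.piece K ω) ^ t
        ≤ ∑ ω : Fin n → Λ, ENNReal.ofReal (F.wordRatio ω ^ t) * Metric.ediam K ^ t := by
          refine Finset.sum_le_sum fun ω _ => ?_
          rw [← ENNReal.ofReal_rpow_of_pos (F.wordRatio_pos ω), ← ENNReal.mul_rpow_of_nonneg _ _ ht]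
          exact ENNReal.rpow_le_rpow (F.ediam_piece_le K ω) ht
      _ = Metric.ediam K ^ t := by
          rw [← Finset.sum_mul, ← ENNReal.ofReal_sum_of_nonneg fun ω _ =>
            Real.rpow_nonneg (F.wordRatio_pos ω).le _, F.sum_wordRatio_rpow, hsum]
          simp
  refine ne_top_of_le_ne_top (ENNReal.rpow_ne_top_of_nonneg ht hDtop) (h.trans ?_)
  refine (liminf_le_liminf (Eventually.of_forall hle)).trans ?_
  rw [liminf_const]

theorem wordMap_wordPrefix_succ (F : IFS d Λ) (a : ℕ → Λ) (n : ℕ)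
    (x : EuclideanSpace ℝ (Fin d)) :
    F.wordMap (n + 1) (wordPrefix a (n + 1)) x = F.wordMap n (wordPrefix a n) (F.map (a n) x) := by
  induction n generalizing a with
  | zero => rfl
  | succ n ih =>
    have := ih fun j => a (j + 1)
    rw [← tail_wordPrefix, ← tail_wordPrefix] at this
    rw [wordMap, Function.comp_apply, this]
    rfl

theorem wordMap_injective (F : IFS d Λ) {n : ℕ} (ω : Fin n → Λ) :
    Function.Injective (F.wordMap n ω) := fun x y h => by
  have := F.dist_wordMap ω x y
  rw [h, dist_self, eq_comm, mul_eq_zero] at this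
  exact dist_eq_zero.1 (this.resolve_left (F.wordRatio_pos ω).ne')

theorem wordMap_surjective (F : IFS d Λ) {n : ℕ} (ω : Fin n → Λ) :
    Function.Surjective (F.wordMap n ω) := by
  have hinj : Function.Injective (Matrix.toEuclideanLin (F.wordRot n ω)) :=
    (injective_iff_map_eq_zero _).2 fun x hx => by
      rw [← norm_eq_zero, ← norm_toEuclideanLin_of_mem (F.wordRot_mem ω), hx, norm_zero]
  intro y
  obtain ⟨x, hx⟩ := (LinearMap.injective_iff_surjective.1 hinj)
    ((F.wordRatio ω)⁻¹ • (y - F.wordMap n ω 0))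
  refine ⟨x, ?_⟩
  rw [wordMap_eq, hx, smul_inv_smul₀ (F.wordRatio_pos ω).ne', sub_add_cancel]

theorem ball_subset_image_wordMap (F : IFS d Λ) {n : ℕ} (ω : Fin n → Λ)
    (z : EuclideanSpace ℝ (Fin d)) (ε : ℝ) :
    Metric.ball (F.wordMap n ω z) (F.wordRatio ω * ε) ⊆ F.wordMap n ω '' Metric.ball z ε := by
  intro y hy
  obtain ⟨x, rfl⟩ := F.wordMap_surjective ω y
  rw [Metric.mem_ball, dist_wordMap] at hy
  exact ⟨x, lt_of_mul_lt_mul_left hy (F.wordRatio_pos ω).le, rfl⟩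

/-- The images of `U` shrink along the prefixes of a sequence. -/
theorem image_wordPrefix_antitone (F : IFS d Λ) {U : Set (EuclideanSpace ℝ (Fin d))}
    (hU : ∀ i, F.map i '' U ⊆ U) (a : ℕ → Λ) :
    Antitone fun n => F.wordMap n (wordPrefix a n) '' U := by
  refine antitone_nat_of_succ_le fun n => ?_
  rintro _ ⟨x, hx, rfl⟩
  rw [wordMap_wordPrefix_succ]
  exact ⟨_, hU _ ⟨x, hx, rfl⟩, rfl⟩

/-- The coding map from sequences to the limit set. -/
theorem IsLimitSet.exists_codingMap {F : IFS d Λ} {K : Set (EuclideanSpace ℝ (Fin d))}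
    (hK : F.IsLimitSet K) : ∃ π : (ℕ → Λ) → EuclideanSpace ℝ (Fin d),
      ∀ a n, π a ∈ F.piece K (wordPrefix a n) := by
  have h : ∀ a : ℕ → Λ, (⋂ n, F.piece K (wordPrefix a n)).Nonempty := fun a =>
    IsCompact.nonempty_iInter_of_sequence_nonempty_isCompact_isClosed _
      (fun n => F.image_wordPrefix_antitone
        (fun i => Set.image_subset_iff.2 fun _ hx => hK.map_mem i hx) a (Nat.le_succ n))
      (fun n => hK.nonempty.image _) (hK.isCompact_piece _) fun n => (hK.isCompact_piece _).isClosed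
  choose π hπ using h
  exact ⟨π, fun a n => Set.mem_iInter.1 (hπ a) n⟩

theorem IsLimitSet.measurable_codingMap [Finite Λ] [MeasurableSpace Λ] [MeasurableSingletonClass Λ]
    {F : IFS d Λ} {K : Set (EuclideanSpace ℝ (Fin d))} (hK : F.IsLimitSet K)
    {π : (ℕ → Λ) → EuclideanSpace ℝ (Fin d)} (hπ : ∀ a n, π a ∈ F.piece K (wordPrefix a n)) :
    Measurable π := by
  obtain ⟨x, hx⟩ := hK.nonempty
  obtain ⟨a, b, -, -, hb, hb1, hab⟩ := F.exists_ratio_bounds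
  refine measurable_of_tendsto_metrizable
    (f := fun n a => F.wordMap n (wordPrefix a n) x) (fun n => ?_) (tendsto_pi_nhds.2 fun a => ?_)
  · exact (measurable_of_countable fun ω : Fin n → Λ => F.wordMap n ω x).comp
      (measurable_pi_lambda _ fun j => measurable_pi_apply _)
  · rw [tendsto_iff_dist_tendsto_zero]
    refine squeeze_zero (fun _ => dist_nonneg) (g := fun n => b ^ n * Metric.diam K)
      (fun n => ?_) ?_
    · obtain ⟨z, hz, hza⟩ := hπ a n
      rw [← hza, dist_wordMap]
      exact mul_le_mul (F.wordRatio_le_pow (fun i => (hab i).2) _)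
        (Metric.dist_le_diam_of_mem hK.isCompact.isBounded hx hz) dist_nonneg (pow_nonneg hb.le _)
    · simpa using (tendsto_pow_atTop_nhds_zero_of_lt_one hb.le hb1).mul_const (Metric.diam K)

/-- The length `n` is the stopping time of the sequence `a` at scale `r`: the first time at which
the contraction ratio of the prefix is at most `r`. -/
def IsStop (F : IFS d Λ) (r : ℝ) (a : ℕ → Λ) (n : ℕ) : Prop :=
  F.wordRatio (wordPrefix a n) ≤ r ∧ ∀ m < n, r < F.wordRatio (wordPrefix a m)

theorem exists_isStop [Finite Λ] (F : IFS d Λ) {r : ℝ} (hr : 0 < r) (a : ℕ → Λ) :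
    ∃ n, F.IsStop r a n := by
  classical
  obtain ⟨c, b, -, -, hb, hb1, hab⟩ := F.exists_ratio_bounds
  obtain ⟨N, hN⟩ := exists_pow_lt_of_lt_one hr hb1
  have h : ∃ n, F.wordRatio (wordPrefix a n) ≤ r :=
    ⟨N, (F.wordRatio_le_pow (fun i => (hab i).2) _).trans hN.le⟩
  exact ⟨Nat.find h, Nat.find_spec h, fun m hm => not_le.1 (Nat.find_min h hm)⟩

theorem IsStop.mul_le_wordRatio {F : IFS d Λ} {c : ℝ} (hc : 0 < c) (hc1 : c ≤ 1)
    (hF : ∀ i, c ≤ F.ratio i) {r : ℝ} (hr : 0 < r) (hr1 : r ≤ 1) {a : ℕ → Λ} {n : ℕ}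
    (h : F.IsStop r a n) : c * r ≤ F.wordRatio (wordPrefix a n) := by
  cases n with
  | zero => simpa [wordRatio] using mul_le_one₀ hc1 hr.le hr1
  | succ n =>
    rw [wordRatio_wordPrefix_succ, mul_comm]
    exact mul_le_mul (h.2 n n.lt_succ_self).le (hF _) hc.le (F.wordRatio_pos _).le

/-- Distinct stopping words at the same scale have disjoint images of the open set: they branch
before either of them stops. -/
theorem IsStop.disjoint_image {F : IFS d Λ} {U : Set (EuclideanSpace ℝ (Fin d))}
    (hU : ∀ i, F.map i '' U ⊆ U) (hdisj : ∀ i j, i ≠ j → F.map i '' U ∩ F.map j '' U = ∅)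
    {r : ℝ} {a a' : ℕ → Λ} {n n' : ℕ} (h : F.IsStop r a n) (h' : F.IsStop r a' n')
    (hne : (⟨n, wordPrefix a n⟩ : Σ n, Fin n → Λ) ≠ ⟨n', wordPrefix a' n'⟩) :
    Disjoint (F.wordMap n (wordPrefix a n) '' U) (F.wordMap n' (wordPrefix a' n') '' U) := by
  classical
  have hpre : ∀ m, (∀ j < m, a j = a' j) → wordPrefix a m = wordPrefix a' m :=
    fun m hm => funext fun j => hm j j.2
  have hex : ∃ j, j < n ∧ j < n' ∧ a j ≠ a' j := by
    by_contra! hcon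
    refine hne ?_
    rcases lt_trichotomy n n' with hlt | rfl | hlt
    · have := h'.2 n hlt
      rw [← hpre n fun j hj => hcon j hj (hj.trans hlt)] at this
      exact absurd h.1 (not_le.2 this)
    · rw [hpre n fun j hj => hcon j hj hj]
    · have := h.2 n' hlt
      rw [hpre n' fun j hj => hcon j (hj.trans hlt) hj] at this
      exact absurd h'.1 (not_le.2 this)
  obtain ⟨hj, hj', hne'⟩ := Nat.find_spec hex
  set j := Nat.find hex with hjdef
  have heq : wordPrefix a j = wordPrefix a' j := hpre j fun i hi => by
    by_contra hi'
    exact Nat.find_min hex hi ⟨hi.trans hj, hi.trans hj', hi'⟩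
  refine Disjoint.mono (F.image_wordPrefix_antitone hU a hj)
    (F.image_wordPrefix_antitone hU a' hj') (Set.disjoint_left.2 ?_)
  rintro _ ⟨x, hx, rfl⟩ ⟨y, hy, hxy⟩
  simp only [Nat.succ_eq_add_one, wordMap_wordPrefix_succ] at hxy
  rw [heq] at hxy
  have hmem : F.map (a j) x ∈ F.map (a j) '' U ∩ F.map (a' j) '' U :=
    ⟨⟨x, hx, rfl⟩, ⟨y, hy, F.wordMap_injective _ hxy⟩⟩
  rw [hdisj _ _ hne'] at hmem
  exact hmem

/-- The stopping words at scale `r` whose pieces meet `A`. -/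
def stoppingWords (F : IFS d Λ) (K A : Set (EuclideanSpace ℝ (Fin d))) (r : ℝ) :
    Set (Σ n, Fin n → Λ) :=
  {τ | (∃ a, F.IsStop r a τ.1 ∧ wordPrefix a τ.1 = τ.2) ∧ (F.piece K τ.2 ∩ A).Nonempty}

/-- Packing: a set of diameter at most `r` meets a bounded number of pieces of stopping words at
scale `r`, since their images of a ball in the open set are disjoint, of radius comparable to `r`,
and lie in a ball of radius comparable to `r`. -/
theorem exists_tsum_stoppingWords_le [Finite Λ] {F : IFS d Λ} (hF : F.OpenSetCondition)
    {K : Set (EuclideanSpace ℝ (Fin d))} (hK : F.IsLimitSet K) :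
    ∃ N : ℝ≥0, 0 < N ∧ ∀ (A : Set (EuclideanSpace ℝ (Fin d))) (r : ℝ), 0 < r → r ≤ 1 →
      Metric.ediam A ≤ ENNReal.ofReal r → ∑' _τ : F.stoppingWords K A r, (1 : ℝ≥0∞) ≤ N := by
  obtain ⟨U, hUo, ⟨z, hz⟩, hU, hdisj⟩ := hF
  obtain ⟨ε, hε, hball⟩ := Metric.isOpen_iff.1 hUo z hz
  obtain ⟨c, b, hc, hc1, -, -, hab⟩ := F.exists_ratio_bounds
  obtain ⟨M, hM⟩ := hK.isCompact.isBounded.subset_closedBall z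
  obtain ⟨k₀, hk₀⟩ := hK.nonempty
  have hM0 : 0 ≤ M := dist_nonneg.trans (hM hk₀)
  have hN : 0 < ((M + 2 + ε) / (c * ε)) ^ d := by positivity
  refine ⟨(((M + 2 + ε) / (c * ε)) ^ d).toNNReal, Real.toNNReal_pos.2 hN, fun A r hr hr1 hA => ?_⟩
  rcases A.eq_empty_or_nonempty with rfl | ⟨p, hp⟩
  · simp [stoppingWords]
  set v := volume (Metric.ball (0 : EuclideanSpace ℝ (Fin d)) 1) with hv
  have hv0 : v ≠ 0 := (Metric.measure_ball_pos volume _ one_pos).ne'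
  have hvtop : v ≠ ∞ := measure_ball_lt_top.ne
  have hfin : Module.finrank ℝ (EuclideanSpace ℝ (Fin d)) = d := by simp
  have hB : ∀ τ ∈ F.stoppingWords K A r,
      c * r ≤ F.wordRatio τ.2 ∧ F.wordRatio τ.2 ≤ r ∧
      Metric.ball (F.wordMap τ.1 τ.2 z) (F.wordRatio τ.2 * ε) ⊆
        Metric.ball p (r * (M + 2 + ε)) := by
    rintro ⟨n, ω⟩ ⟨⟨a, ha, hω⟩, ⟨q, ⟨k, hk, rfl⟩, hqA⟩⟩
    dsimp only at ha hω hqA ⊢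
    subst hω
    refine ⟨ha.mul_le_wordRatio hc hc1.le (fun i => (hab i).1) hr hr1, ha.1, ?_⟩
    refine Metric.ball_subset_ball' ?_
    have h1 : dist (F.wordMap n (wordPrefix a n) k) p ≤ r := by
      have := (Metric.edist_le_ediam_of_mem hqA hp).trans hA
      rw [edist_dist] at this
      exact (ENNReal.ofReal_le_ofReal_iff hr.le).1 this
    have h2 : dist (F.wordMap n (wordPrefix a n) z) (F.wordMap n (wordPrefix a n) k) ≤ r * M := by
      rw [dist_wordMap, dist_comm]
      exact mul_le_mul ha.1 (hM hk) dist_nonneg hr.le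
    have h3 := dist_triangle (F.wordMap n (wordPrefix a n) z) (F.wordMap n (wordPrefix a n) k) p
    have h4 : F.wordRatio (wordPrefix a n) * ε ≤ r * ε := mul_le_mul_of_nonneg_right ha.1 hε.le
    nlinarith
  have hpack := tsum_meas_le_meas_iUnion_of_disjoint volume
    (As := fun τ : F.stoppingWords K A r =>
      Metric.ball (F.wordMap τ.1.1 τ.1.2 z) (F.wordRatio τ.1.2 * ε))
    (fun _ => measurableSet_ball) (by
      rintro ⟨⟨n, ω⟩, ⟨a, ha, hω⟩, hτ⟩ ⟨⟨n', ω'⟩, ⟨a', ha', hω'⟩, hτ'⟩ hne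
      dsimp only at ha hω hτ ha' hω' hτ'
      subst hω hω'
      have hne' : (⟨n, wordPrefix a n⟩ : Σ n, Fin n → Λ) ≠ ⟨n', wordPrefix a' n'⟩ :=
        fun h => hne (Subtype.ext h)
      exact (IsStop.disjoint_image hU hdisj ha ha' hne').mono
        ((F.ball_subset_image_wordMap _ _ _).trans (Set.image_mono hball))
        ((F.ball_subset_image_wordMap _ _ _).trans (Set.image_mono hball)))
  have hlow : ∑' _τ : F.stoppingWords K A r, ENNReal.ofReal ((c * r * ε) ^ d) * v ≤
      ENNReal.ofReal ((r * (M + 2 + ε)) ^ d) * v := by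
    have h1 : volume (Metric.ball p (r * (M + 2 + ε))) =
        ENNReal.ofReal ((r * (M + 2 + ε)) ^ d) * v := by
      rw [Measure.addHaar_ball_of_pos _ _ (by positivity), hfin]
    rw [← h1]
    refine le_trans (ENNReal.tsum_le_tsum fun τ => ?_)
      (hpack.trans (measure_mono (Set.iUnion_subset fun τ => (hB τ.1 τ.2).2.2)))
    rw [Measure.addHaar_ball_of_pos _ _ (mul_pos (F.wordRatio_pos _) hε), hfin]
    have := (hB τ.1 τ.2).1
    gcongr
  have hx : 0 < (c * r * ε) ^ d := by positivity
  have hsplit : (r * (M + 2 + ε)) ^ d = ((M + 2 + ε) / (c * ε)) ^ d * (c * r * ε) ^ d := by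
    rw [← mul_pow]
    congr 1
    field_simp
  rw [hsplit, ENNReal.ofReal_mul hN.le, mul_assoc (ENNReal.ofReal _)] at hlow
  have hone : ENNReal.ofReal ((c * r * ε) ^ d) * v =
      1 * (ENNReal.ofReal ((c * r * ε) ^ d) * v) := (one_mul _).symm
  rw [tsum_congr fun _ : F.stoppingWords K A r => hone, ENNReal.tsum_mul_right,
    ENNReal.mul_le_mul_iff_left
    (mul_ne_zero (ENNReal.ofReal_pos.2 hx).ne' hv0)
    (ENNReal.mul_ne_top ENNReal.ofReal_ne_top hvtop)] at hlow
  exact hlow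

/-- The Bernoulli measure with weights `ρ_i ^ t`, which sum to one, gives the cylinder of a word `ω`
the mass `ρ_ω ^ t`. -/
theorem exists_bernoulli [Fintype Λ] [MeasurableSpace Λ] [MeasurableSingletonClass Λ]
    (F : IFS d Λ) {t : ℝ} (hsum : ∑ i, F.ratio i ^ t = 1) :
    ∃ P : Measure (ℕ → Λ), IsProbabilityMeasure P ∧ ∀ (n : ℕ) (a : ℕ → Λ),
      P {b | wordPrefix b n = wordPrefix a n} =
        ENNReal.ofReal (F.wordRatio (wordPrefix a n) ^ t) := by
  let ν : Measure Λ := ∑ i, ENNReal.ofReal (F.ratio i ^ t) • Measure.dirac i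
  have hν1 : ∀ j, ν {j} = ENNReal.ofReal (F.ratio j ^ t) := by
    classical
    intro j
    simp [ν, Measure.finsetSum_apply, Set.indicator_apply]
  have hν : IsProbabilityMeasure ν := ⟨by
    simp only [ν, Measure.finsetSum_apply, Measure.smul_apply, measure_univ, smul_eq_mul, mul_one]
    rw [← ENNReal.ofReal_sum_of_nonneg fun i _ => Real.rpow_nonneg (F.ratio_pos i).le _, hsum,
      ENNReal.ofReal_one]⟩
  refine ⟨Measure.infinitePi fun _ => ν, inferInstance, fun n a => ?_⟩
  have hset : {b : ℕ → Λ | wordPrefix b n = wordPrefix a n} =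
      Set.pi (Finset.range n : Set ℕ) fun j => {a j} := by
    ext b
    simp [wordPrefix, funext_iff, Fin.forall_iff]
  rw [hset, Measure.infinitePi_pi _ fun _ _ => measurableSet_singleton _]
  simp only [hν1]
  rw [← ENNReal.ofReal_prod_of_nonneg fun i _ => Real.rpow_nonneg (F.ratio_pos _).le _,
    Real.finsetProd_rpow _ _ fun i _ => (F.ratio_pos _).le, Finset.prod_range]
  rfl

/-- The limit set has positive measure in its similarity dimension, by the mass distribution
principle for the image of the Bernoulli measure. -/
theorem IsLimitSet.hausdorffMeasure_ne_zero [Fintype Λ] {F : IFS d Λ} (hF : F.OpenSetCondition)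
    {K : Set (EuclideanSpace ℝ (Fin d))} (hK : F.IsLimitSet K) {t : ℝ} (ht : 0 < t)
    (hsum : ∑ i, F.ratio i ^ t = 1) : Measure.hausdorffMeasure t K ≠ 0 := by
  let _ : MeasurableSpace Λ := ⊤
  obtain ⟨P, hP, hcyl⟩ := F.exists_bernoulli hsum
  obtain ⟨π, hπ⟩ := hK.exists_codingMap
  have hπm : Measurable π := hK.measurable_codingMap hπ
  obtain ⟨N, hN, hpack⟩ := exists_tsum_stoppingWords_le hF hK
  have hN0 : (N : ℝ≥0∞) ≠ 0 := by exact_mod_cast hN.ne'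
  have hscale : ∀ (A : Set (EuclideanSpace ℝ (Fin d))) (r : ℝ), 0 < r → r ≤ 1 →
      Metric.ediam A ≤ ENNReal.ofReal r → P (π ⁻¹' A) ≤ N * ENNReal.ofReal r ^ t := by
    intro A r hr hr1 hA
    calc P (π ⁻¹' A) ≤ P (⋃ τ : F.stoppingWords K A r, {b | wordPrefix b τ.1.1 = τ.1.2}) := by
          refine measure_mono fun a ha => ?_
          obtain ⟨n, hn⟩ := F.exists_isStop hr a
          exact Set.mem_iUnion.2 ⟨⟨⟨n, wordPrefix a n⟩, ⟨a, hn, rfl⟩, ⟨π a, hπ a n, ha⟩⟩, rfl⟩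
      _ ≤ ∑' τ : F.stoppingWords K A r, P {b | wordPrefix b τ.1.1 = τ.1.2} :=
          measure_iUnion_le _
      _ ≤ ∑' _τ : F.stoppingWords K A r, 1 * ENNReal.ofReal r ^ t := by
          refine ENNReal.tsum_le_tsum ?_
          rintro ⟨⟨n, ω⟩, ⟨a, ha, hω⟩, -⟩
          dsimp only at ha hω ⊢
          subst hω
          rw [hcyl, one_mul, ENNReal.ofReal_rpow_of_pos hr]
          exact ENNReal.ofReal_le_ofReal
            (Real.rpow_le_rpow (F.wordRatio_pos _).le ha.1 ht.le)
      _ ≤ N * ENNReal.ofReal r ^ t := by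
          rw [ENNReal.tsum_mul_right]
          gcongr
          exact hpack A r hr hr1 hA
  -- letting `r` decrease to the diameter also covers sets of diameter zero
  have hdiam : ∀ A : Set (EuclideanSpace ℝ (Fin d)), Metric.ediam A ≤ 2⁻¹ →
      P (π ⁻¹' A) ≤ N * Metric.ediam A ^ t := by
    intro A hA
    have hAtop : Metric.ediam A ≠ ∞ := ne_top_of_le_ne_top (by simp) hA
    set δ := (Metric.ediam A).toReal with hδ
    have hδA : ENNReal.ofReal δ = Metric.ediam A := ENNReal.ofReal_toReal hAtop
    have hδ1 : δ < 1 := by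
      have := ENNReal.toReal_mono (by simp) hA
      rw [← hδ] at this
      norm_num at this
      linarith
    have hlim : Tendsto (fun r : ℝ => (N : ℝ≥0∞) * ENNReal.ofReal r ^ t) (𝓝[>] δ)
        (𝓝 (N * Metric.ediam A ^ t)) := by
      rw [← hδA]
      refine ENNReal.Tendsto.const_mul ?_ (Or.inr ENNReal.coe_ne_top)
      exact ((ENNReal.continuous_rpow_const.comp ENNReal.continuous_ofReal).tendsto δ).mono_left
        nhdsWithin_le_nhds
    refine ge_of_tendsto hlim ?_
    filter_upwards [Ioo_mem_nhdsGT hδ1] with r hr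
    refine hscale A r (ENNReal.toReal_nonneg.trans_lt hr.1) hr.2.le ?_
    rw [← hδA]
    exact ENNReal.ofReal_le_ofReal hr.1.le
  have hle : (N : ℝ≥0∞)⁻¹ • P.map π ≤ Measure.hausdorffMeasure t := by
    refine Measure.le_hausdorffMeasure t _ 2⁻¹ (by simp) fun A hA => ?_
    rw [Measure.smul_apply, smul_eq_mul, ENNReal.inv_mul_le_iff hN0 ENNReal.coe_ne_top]
    calc P.map π A ≤ P.map π (closure A) := measure_mono subset_closure
      _ = P (π ⁻¹' closure A) := Measure.map_apply hπm isClosed_closure.measurableSet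
      _ ≤ N * Metric.ediam A ^ t := by
        rw [← Metric.ediam_closure A]
        exact hdiam _ (by rwa [Metric.ediam_closure])
  have hKm : MeasurableSet K := hK.isCompact.measurableSet
  have hPK : P.map π K = 1 := by
    rw [Measure.map_apply hπm hKm]
    have : π ⁻¹' K = Set.univ := Set.eq_univ_of_forall fun a => by
      obtain ⟨k, hk, hka⟩ := hπ a 0
      have hka' : k = π a := hka
      rwa [Set.mem_preimage, ← hka']
    rw [this, measure_univ]
  intro h0
  have := hle K
  rw [h0, Measure.smul_apply, hPK, smul_eq_mul, mul_one, nonpos_iff_eq_zero,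
    ENNReal.inv_eq_zero] at this
  exact ENNReal.coe_ne_top this

/-- Under the open set condition a limit set of positive dimension `s` satisfies `∑ ρ_i ^ s = 1` and
has positive and finite `s`-dimensional Hausdorff measure. -/
theorem IsLimitSet.dimension_formula [Fintype Λ] {F : IFS d Λ} (hF : F.OpenSetCondition)
    {K : Set (EuclideanSpace ℝ (Fin d))} (hK : F.IsLimitSet K) {s : ℝ}
    (hs : s = (dimH K).toReal) (hs0 : 0 < s) : ∑ i, F.ratio i ^ s = 1 ∧
      Measure.hausdorffMeasure s K ≠ 0 ∧ Measure.hausdorffMeasure s K ≠ ∞ := by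
  obtain ⟨x, hx⟩ := hK.nonempty
  have : Nonempty Λ := ⟨(hK.exists_map hx).choose⟩
  obtain ⟨t, ht, hsum⟩ := F.exists_sum_ratio_rpow_eq_one
  lift t to ℝ≥0 using ht
  have htop := hK.hausdorffMeasure_ne_top t.2 hsum
  have hst : s ≤ t :=
    hs ▸ ENNReal.toReal_mono ENNReal.coe_ne_top (dimH_le_of_hausdorffMeasure_ne_top htop)
  have hne := hK.hausdorffMeasure_ne_zero hF (hs0.trans_le hst) hsum
  have hst' : s = t := by
    rw [hs, dimH_of_hausdorffMeasure_ne_zero_ne_top hne htop, ENNReal.coe_toReal]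
  rw [hst']
  exact ⟨hsum, hne, htop⟩

end Hutchinson

end IFS

/-! ### The natural measure of the disjoint pieces -/

namespace IFS

variable {d : ℕ} {Λ : Type*} [LinearOrder Λ]

theorem hatPiece_subset (F : IFS d Λ) (K : Set (EuclideanSpace ℝ (Fin d))) {n : ℕ}
    (ω : Fin n → Λ) : F.hatPiece K ω ⊆ F.piece K ω := Set.sdiff_subset

theorem pairwise_disjoint_hatPiece (F : IFS d Λ) (K : Set (EuclideanSpace ℝ (Fin d))) (n : ℕ) :
    Pairwise fun ω α : Fin n → Λ => Disjoint (F.hatPiece K ω) (F.hatPiece K α) := by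
  have key : ∀ ω α : Fin n → Λ, toLex ω < toLex α →
      Disjoint (F.hatPiece K ω) (F.hatPiece K α) := fun ω α h =>
    Set.disjoint_left.2 fun x hx hx' =>
      hx.2 (Set.mem_iUnion₂.2 ⟨α, h, F.hatPiece_subset K ω hx, F.hatPiece_subset K α hx'⟩)
  intro ω α hne
  rcases lt_or_gt_of_ne (toLex.injective.ne hne) with h | h
  · exact key ω α h
  · exact (key α ω h).symm

variable [Fintype Λ]

theorem IsLimitSet.iUnion_hatPiece {F : IFS d Λ} {K : Set (EuclideanSpace ℝ (Fin d))}
    (hK : F.IsLimitSet K) (n : ℕ) : ⋃ ω : Fin n → Λ, F.hatPiece K ω = K := by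
  refine Set.Subset.antisymm ?_ fun x hx => ?_
  · exact (Set.iUnion_mono fun ω => F.hatPiece_subset K ω).trans (hK.iUnion_piece n).le
  · -- the lexicographically largest word whose piece contains `x` is the right one
    rw [← hK.iUnion_piece n, Set.mem_iUnion] at hx
    obtain ⟨ω, hω, hmax⟩ := Set.exists_max_image {ω : Fin n → Λ | x ∈ F.piece K ω} toLex
      (Set.toFinite _) hx
    refine Set.mem_iUnion.2 ⟨ω, hω, fun h => ?_⟩
    obtain ⟨α, hα, -, hxα⟩ := Set.mem_iUnion₂.1 h
    exact absurd hα (not_lt.2 (hmax α hxα))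

theorem IsLimitSet.measurableSet_hatPiece {F : IFS d Λ} {K : Set (EuclideanSpace ℝ (Fin d))}
    (hK : F.IsLimitSet K) {n : ℕ} (ω : Fin n → Λ) : MeasurableSet (F.hatPiece K ω) :=
  (hK.isCompact_piece ω).measurableSet.diff <| MeasurableSet.iUnion fun α =>
    MeasurableSet.iUnion fun _ =>
      (hK.isCompact_piece ω).measurableSet.inter (hK.isCompact_piece α).measurableSet

theorem cocycle_of_mem (F : IFS d Λ) (K : Set (EuclideanSpace ℝ (Fin d))) {n : ℕ} {ω : Fin n → Λ}
    {x : EuclideanSpace ℝ (Fin d)} (hx : x ∈ F.hatPiece K ω) :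
    F.cocycle K x n = F.wordRatio ω := by
  rw [cocycle, Finset.sum_eq_single ω, Set.indicator_of_mem hx]
  · intro α _ hne
    exact Set.indicator_of_notMem
      (Set.disjoint_left.1 (F.pairwise_disjoint_hatPiece K n hne.symm) hx) _
  · simp

/-- The pieces contribute at most `ρ_ω ^ s` each to the total measure, and these bounds add up to
the total, so they are attained. -/
theorem IsLimitSet.hausdorffMeasure_hatPiece {F : IFS d Λ} {K : Set (EuclideanSpace ℝ (Fin d))}
    (hK : F.IsLimitSet K) {s : ℝ} (hs : 0 ≤ s) (hsum : ∑ i, F.ratio i ^ s = 1)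
    (htop : Measure.hausdorffMeasure s K ≠ ∞) {n : ℕ} (ω : Fin n → Λ) :
    Measure.hausdorffMeasure s (F.hatPiece K ω) =
      ENNReal.ofReal (F.wordRatio ω ^ s) * Measure.hausdorffMeasure s K := by
  set H : Measure (EuclideanSpace ℝ (Fin d)) := Measure.hausdorffMeasure s with hH
  have hle : ∀ α : Fin n → Λ, H (F.hatPiece K α) ≤ ENNReal.ofReal (F.wordRatio α ^ s) * H K := by
    intro α
    refine (measure_mono (F.hatPiece_subset K α)).trans ?_
    have h := (F.lipschitzWith_wordMap α).hausdorffMeasure_image_le hs K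
    rw [← ENNReal.ofReal_rpow_of_pos (F.wordRatio_pos α)]
    exact h
  have hsumK : ∑ α : Fin n → Λ, H (F.hatPiece K α) =
      ∑ α : Fin n → Λ, ENNReal.ofReal (F.wordRatio α ^ s) * H K := by
    rw [← Finset.sum_mul, ← ENNReal.ofReal_sum_of_nonneg fun α _ =>
      Real.rpow_nonneg (F.wordRatio_pos α).le _, F.sum_wordRatio_rpow, hsum, one_pow,
      ENNReal.ofReal_one, one_mul, ← tsum_fintype (L := .unconditional _),
      ← measure_iUnion (F.pairwise_disjoint_hatPiece K n) fun α => hK.measurableSet_hatPiece α,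
      hK.iUnion_hatPiece]
  refine le_antisymm (hle ω) (le_of_not_gt fun hlt => ?_)
  have hfin : ∑ α : Fin n → Λ, H (F.hatPiece K α) ≠ ∞ := ENNReal.sum_ne_top.2 fun α _ =>
    ne_top_of_le_ne_top htop ((measure_mono (F.hatPiece_subset K α)).trans
      (measure_mono ((Set.subset_iUnion _ α).trans (hK.iUnion_piece n).le)))
  rw [← Finset.add_sum_erase _ _ (Finset.mem_univ ω), ← Finset.add_sum_erase _
    (fun α => ENNReal.ofReal (F.wordRatio α ^ s) * H K) (Finset.mem_univ ω)] at hsumK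
  rw [← Finset.add_sum_erase _ _ (Finset.mem_univ ω)] at hfin
  exact (ENNReal.add_lt_add_of_lt_of_le (ENNReal.add_ne_top.1 hfin).2 hlt
    (Finset.sum_le_sum fun α _ => hle α)).ne hsumK

theorem IsLimitSet.integral_cocycle_le {F : IFS d Λ} {K : Set (EuclideanSpace ℝ (Fin d))}
    (hK : F.IsLimitSet K) {μ : Measure (EuclideanSpace ℝ (Fin d))} (hμ : μ K = 1) {b : ℝ}
    (hb : ∀ i, F.ratio i ≤ b) (n : ℕ) :
    0 ≤ ∫ x in K, F.cocycle K x n ∂μ ∧ ∫ x in K, F.cocycle K x n ∂μ ≤ b ^ n := by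
  have hcoc : ∀ x ∈ K, 0 ≤ F.cocycle K x n ∧ F.cocycle K x n ≤ b ^ n := by
    intro x hx
    rw [← hK.iUnion_hatPiece n, Set.mem_iUnion] at hx
    obtain ⟨ω, hω⟩ := hx
    rw [F.cocycle_of_mem K hω]
    exact ⟨(F.wordRatio_pos ω).le, F.wordRatio_le_pow hb ω⟩
  refine ⟨setIntegral_nonneg hK.isCompact.measurableSet fun x hx => (hcoc x hx).1, ?_⟩
  have h := norm_setIntegral_le_of_norm_le_const (μ := μ) (s := K) (f := fun x => F.cocycle K x n)
    (C := b ^ n) (by simp [hμ]) fun x hx => by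
      rw [Real.norm_of_nonneg (hcoc x hx).1]
      exact (hcoc x hx).2
  rw [measureReal_def, hμ, ENNReal.toReal_one, mul_one] at h
  exact (le_abs_self _).trans h

end IFS

/-! ### From the contraction hypothesis to a contracting step -/

section Contraction

variable {d : ℕ} {Λ : Type*} [Fintype Λ] [LinearOrder Λ] {X : Type*} [MetricSpace X]
  [MulAction SL(d + 1, ℝ) X] {F : IFS d Λ} {K : Set (EuclideanSpace ℝ (Fin d))}
  {μ : Measure (EuclideanSpace ℝ (Fin d))} {f : ℕ+ → X → ℝ≥0∞} {β γ₀ : ℝ}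

theorem ContractionHypothesis.exists_log_lipschitz (h : ContractionHypothesis F K μ f β γ₀)
    {S : Set SL(d + 1, ℝ)} (hS : EntriesBounded S) : ∃ C : ℝ≥0, 1 ≤ C ∧ ∀ g ∈ S, ∀ x k,
      f k x ≤ C * f k (g • x) ∧ f k (g • x) ≤ C * f k x := by
  obtain ⟨O, hO, hSO, hOb⟩ := hS.exists_nhds
  obtain ⟨C, hC, h'⟩ := h.log_lipschitz O hO hOb
  refine ⟨C, hC, fun g hg x k => ⟨?_, (h' g (hSO hg) x k).2⟩⟩
  have hC0 : (C : ℝ≥0∞) ≠ 0 := by exact_mod_cast (zero_lt_one.trans_le hC).ne'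
  exact (ENNReal.inv_mul_le_iff hC0 ENNReal.coe_ne_top).1 (h' g (hSO hg) x k).1

theorem ContractionHypothesis.isHeight (h : ContractionHypothesis F K μ f β γ₀) (k : ℕ+) :
    IsHeight d (f k) where
  rot_invariant g x hg := h.rot_invariant k x g hg
  le_mul S hS := by
    obtain ⟨C, hC, h'⟩ := h.exists_log_lipschitz hS
    exact ⟨C, hC, fun g hg x => (h' g hg x k).2⟩

/-- On a piece the integrand of the contraction hypothesis is comparable to a constant, so that the
integral dominates a sum over words. -/
theorem ContractionHypothesis.exists_sum_le_lintegral (h : ContractionHypothesis F K μ f β γ₀)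
    (hK : F.IsLimitSet K) {s : ℝ}
    (hμ : ∀ (n : ℕ) (ω : Fin n → Λ), μ (F.hatPiece K ω) = ENNReal.ofReal (F.wordRatio ω ^ s)) :
    ∃ C : ℝ≥0, 1 ≤ C ∧ ∀ (k : ℕ+) (γ : ℝ) (y : X),
      ∑ ω : Fin k → Λ, ENNReal.ofReal ((F.power k).ratio ω ^ (s - γ)) *
          f k ((F.power k).stepElt ω • y) ≤
        C * ∫⁻ x in K, ENNReal.ofReal (F.cocycle K x k ^ (-γ)) *
          f k (gFlow d (F.cocycle K x k) • uMat x • y) ∂μ := by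
  obtain ⟨C, hC, hCu⟩ := h.exists_log_lipschitz (entriesBounded_uMat hK.isCompact)
  refine ⟨C, hC, fun k γ y => ?_⟩
  have hsplit : ∫⁻ x in K, ENNReal.ofReal (F.cocycle K x k ^ (-γ)) *
      f k (gFlow d (F.cocycle K x k) • uMat x • y) ∂μ =
      ∑ ω : Fin k → Λ, ∫⁻ x in F.hatPiece K ω, ENNReal.ofReal (F.cocycle K x k ^ (-γ)) *
      f k (gFlow d (F.cocycle K x k) • uMat x • y) ∂μ := by
    rw [← tsum_fintype (L := .unconditional _), ← lintegral_iUnion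
      (fun ω => hK.measurableSet_hatPiece ω) (F.pairwise_disjoint_hatPiece K k),
      hK.iUnion_hatPiece]
  rw [hsplit, Finset.mul_sum]
  refine Finset.sum_le_sum fun ω _ => ?_
  set q := (F.power k).stepElt ω with hq
  have hpos := F.wordRatio_pos ω
  have hpoint : ∀ x ∈ F.hatPiece K ω, ENNReal.ofReal (F.wordRatio ω ^ (-γ)) * f k (q • y) ≤
      C * (ENNReal.ofReal (F.cocycle K x k ^ (-γ)) *
        f k (gFlow d (F.cocycle K x k) • uMat x • y)) := by
    intro x hx
    rw [F.cocycle_of_mem K hx]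
    obtain ⟨x', hx', rfl⟩ := F.hatPiece_subset K ω hx
    have hstep : gFlow d (F.wordRatio ω) * uMat (F.wordMap k ω x') =
        rotLift _ (F.wordRot_mem ω) * uMat x' * q := by
      rw [← F.map_power k]
      exact (F.power k).gFlow_mul_uMat_map ω x'
    rw [smul_smul, hstep, mul_smul, mul_smul, h.rot_invariant k _ _ (rotLift_mem _ _),
      mul_left_comm]
    exact mul_le_mul_right (hCu _ ⟨x', hx', rfl⟩ (q • y) k).1 _
  calc ENNReal.ofReal ((F.power k).ratio ω ^ (s - γ)) * f k (q • y)
      = ENNReal.ofReal (F.wordRatio ω ^ (-γ)) * f k (q • y) * μ (F.hatPiece K ω) := by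
        have h1 : (F.power k).ratio ω ^ (s - γ) = F.wordRatio ω ^ (-γ) * F.wordRatio ω ^ s := by
          rw [← Real.rpow_add hpos, neg_add_eq_sub]
          rfl
        rw [hμ, h1, ENNReal.ofReal_mul (Real.rpow_nonneg hpos.le _)]
        ring
    _ = ∫⁻ _ in F.hatPiece K ω, ENNReal.ofReal (F.wordRatio ω ^ (-γ)) * f k (q • y) ∂μ := by
        rw [setLIntegral_const]
    _ ≤ ∫⁻ x in F.hatPiece K ω, C * (ENNReal.ofReal (F.cocycle K x k ^ (-γ)) *
          f k (gFlow d (F.cocycle K x k) • uMat x • y)) ∂μ :=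
        setLIntegral_mono' (hK.measurableSet_hatPiece ω) hpoint
    _ = _ := lintegral_const_mul' _ _ ENNReal.coe_ne_top

/-- For `γ < β` and a large number `k` of letters, one step of the `k`-th power of the system
contracts `f k` by `1/4` above some level. -/
theorem ContractionHypothesis.exists_contracting_power (h : ContractionHypothesis F K μ f β γ₀)
    (hK : F.IsLimitSet K) {s : ℝ} (hμK : μ K = 1)
    (hμ : ∀ (n : ℕ) (ω : Fin n → Λ), μ (F.hatPiece K ω) = ENNReal.ofReal (F.wordRatio ω ^ s))
    {γ : ℝ} (hγ₀ : γ₀ ≤ γ) (hγ : γ < β) : ∃ (k : ℕ+) (T : ℝ≥0), 0 < T ∧ ∀ y, T < f k y →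
      ∑ ω : Fin k → Λ, ENNReal.ofReal ((F.power k).ratio ω ^ (s - γ)) *
        f k ((F.power k).stepElt ω • y) ≤ 4⁻¹ * f k y := by
  obtain ⟨C, hC, hsum⟩ := h.exists_sum_le_lintegral hK hμ
  obtain ⟨c, hc, hcontr⟩ := h.contraction
  obtain ⟨a, b, -, -, hb, hb1, hab⟩ := F.exists_ratio_bounds
  have hCc : (0 : ℝ) < C * c := by
    have h1 : (0 : ℝ≥0) < C * c := mul_pos (zero_lt_one.trans_le hC) (zero_lt_one.trans_le hc)
    exact_mod_cast h1
  obtain ⟨n, hn⟩ := exists_pow_lt_of_lt_one (show (0 : ℝ) < 4⁻¹ / (C * c) by positivity)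
    (Real.rpow_lt_one hb.le hb1 (sub_pos.2 hγ))
  set k : ℕ+ := n.succPNat with hk
  obtain ⟨T, hT, hTy⟩ := hcontr k γ hγ₀ hγ.le
  refine ⟨k, T, hT, fun y hy => ((hsum k γ y).trans (mul_le_mul_right (hTy y hy) _)).trans ?_⟩
  obtain ⟨hI0, hI1⟩ := hK.integral_cocycle_le hμK (fun i => (hab i).2) k
  set I := ∫ x in K, F.cocycle K x k ∂μ
  have hI : C * c * I ^ (β - γ) ≤ (4⁻¹ : ℝ) := by
    have h1 : I ^ (β - γ) ≤ (b ^ (β - γ)) ^ n := by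
      calc I ^ (β - γ) ≤ (b ^ (k : ℕ)) ^ (β - γ) := Real.rpow_le_rpow hI0 hI1 (sub_pos.2 hγ).le
        _ = (b ^ (β - γ)) ^ (k : ℕ) := Real.rpow_pow_comm hb.le _ _ |>.symm
        _ ≤ (b ^ (β - γ)) ^ n := pow_le_pow_of_le_one (Real.rpow_nonneg hb.le _)
          (Real.rpow_lt_one hb.le hb1 (sub_pos.2 hγ)).le (by simp [hk])
    have h2 := h1.trans hn.le
    rwa [le_div_iff₀ hCc, mul_comm] at h2
  have hI' : (C : ℝ≥0∞) * c * ENNReal.ofReal (I ^ (β - γ)) ≤ 4⁻¹ := by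
    have h1 := ENNReal.ofReal_le_ofReal hI
    rw [ENNReal.ofReal_mul hCc.le, ENNReal.ofReal_mul C.coe_nonneg, ENNReal.ofReal_coe_nnreal,
      ENNReal.ofReal_coe_nnreal, ENNReal.ofReal_inv_of_pos (by norm_num)] at h1
    simpa using h1
  calc (C : ℝ≥0∞) * (c * f k y * ENNReal.ofReal (I ^ (β - γ)))
      = C * c * ENNReal.ofReal (I ^ (β - γ)) * f k y := by ring
    _ ≤ 4⁻¹ * f k y := mul_le_mul_left hI' _

end Contraction

end FractalDivergence

theorem mainTheorem9 {d : ℕ} {Λ : Type*} [Fintype Λ] [LinearOrder Λ]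
    {X : Type*} [MetricSpace X] [MulAction SL(d + 1, ℝ) X]
    (F : FractalDivergence.IFS d Λ) (hF : F.OpenSetCondition)
    (K : Set (EuclideanSpace ℝ (Fin d))) (hK : F.IsLimitSet K)
    (s : ℝ) (hs : s = (dimH K).toReal)
    (μ : Measure (EuclideanSpace ℝ (Fin d)))
    (hμ : μ = (Measure.hausdorffMeasure s K)⁻¹ • (Measure.hausdorffMeasure s).restrict K)
    (f : ℕ+ → X → ℝ≥0∞) (β γ₀ : ℝ) (hγ₀ : 0 ≤ γ₀) (hγ₀β : γ₀ < β) (hβ : β ≤ s)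
    (hCH : FractalDivergence.ContractionHypothesis F K μ f β γ₀)
    (x₀ : X) (hx₀ : f 1 x₀ ≠ ∞) :
    dimH {x | x ∈ K ∧
        FractalDivergence.DivergentOnAverage (d := d) f (FractalDivergence.uMat x • x₀)}
      ≤ ENNReal.ofReal (s - β) := by
  have hs0 : 0 < s := (hγ₀.trans_lt hγ₀β).trans_le hβ
  obtain ⟨hsum, hne, htop⟩ := hK.dimension_formula hF hs hs0
  have hμK : μ K = 1 := by
    rw [hμ, Measure.smul_apply, Measure.restrict_apply_self, smul_eq_mul,
      ENNReal.inv_mul_cancel hne htop]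
  have hμω : ∀ (n : ℕ) (ω : Fin n → Λ),
      μ (F.hatPiece K ω) = ENNReal.ofReal (F.wordRatio ω ^ s) := by
    intro n ω
    have hsub : F.hatPiece K ω ⊆ K := (Set.subset_iUnion _ ω).trans (hK.iUnion_hatPiece n).le
    rw [hμ, Measure.smul_apply, Measure.restrict_apply (hK.measurableSet_hatPiece ω),
      Set.inter_eq_left.2 hsub, hK.hausdorffMeasure_hatPiece hs0.le hsum htop, smul_eq_mul,
      mul_left_comm, ENNReal.inv_mul_cancel hne htop, mul_one]
  have hγ : ∀ γ ∈ Set.Ioo γ₀ β, dimH {x | x ∈ K ∧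
      FractalDivergence.DivergentOnAverage (d := d) f (FractalDivergence.uMat x • x₀)} ≤
      ENNReal.ofReal (s - γ) := by
    intro γ hγ
    have hsγ : 0 < s - γ := sub_pos.2 (hγ.2.trans_le hβ)
    obtain ⟨k, T, hT, hhigh⟩ := hCH.exists_contracting_power hK hμK hμω hγ.1.le hγ.2
    have hxk : f k x₀ ≠ ∞ := fun h => hx₀ ((hCH.top_indep k 1).le h)
    have hzero := FractalDivergence.hausdorffMeasure_divergent_eq_zero (F.power k) (hK.power k)
      (hCH.isHeight k) hT hsγ hhigh x₀ hxk
    refine dimH_le_of_hausdorffMeasure_ne_top (d := (s - γ).toNNReal) ?_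
    rw [Real.coe_toNNReal _ hsγ.le]
    have hsub : {x | x ∈ K ∧
        FractalDivergence.DivergentOnAverage (d := d) f (FractalDivergence.uMat x • x₀)} ⊆
        {x | x ∈ K ∧ FractalDivergence.DivergesFor d (f k) (FractalDivergence.uMat x • x₀)} :=
      fun x hx => ⟨hx.1, fun M hM => hx.2 k M hM⟩
    rw [measure_mono_null hsub hzero]
    exact ENNReal.zero_ne_top
  have hlim : Tendsto (fun γ => ENNReal.ofReal (s - γ)) (𝓝[<] β) (𝓝 (ENNReal.ofReal (s - β))) :=
    ((ENNReal.continuous_ofReal.comp (continuous_const.sub continuous_id)).tendsto β).mono_left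
      nhdsWithin_le_nhds
  refine ge_of_tendsto hlim ?_
  filter_upwards [Ioo_mem_nhdsLT hγ₀β] with γ h using hγ γ h
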